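/- **Setting.** Fix $x_0<0$, $0<\underline k<\overline k$, $R>0$; primes denote $\partial_x$. Let $c^*\in C^2(\mathbb R)$ be real valued with $c^*\ge 1$ on $\mathbb R$ and $c^*=1$ outside $(0,1)$. For every $k>0$ let $u^*(\cdot,k)$ solve $$u''+k^2c^*(x)u=-\delta(x-x_0)\ \text{ on }\mathbb R,\qquad \lim_{x\to\infty}(u'+iku)=0,\quad \lim_{x\to-\infty}(u'-iku)=0,$$ and put $u_0(x,k)=\dfrac{e^{-ik|x-x_0|}}{2ik}$, $w^*=u^*/u_0$, $g_0^*(k)=w^*(0,k)$. For $x\in[0,1]$, $k>0$, $\log w^*(x,k)$ denotes the logarithm of $w^*$ that is continuous in $k\in(0,\infty)$ and satisfies $\log w^*(x,k)=-\tfrac14\ln c^*(x)-ik\big(\int_{x_0}^x\sqrt{c^*(\xi)}\,d\xi-x+x_0\big)+o(1)$ as $k\to\infty$. Let $V^*(x)=\overline k^{-2}\log w^*(x,\overline k)$ be the exact tail function and define $r^*$ on $[0,1]$ by $V^*(x)=r^*(x)/\overline k$. *Noisy data.* Let $0<\delta\le 1$, and let $g_0\in C^1([\underline k,\overline k];\mathbb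 C)$ be nowhere zero with a continuous logarithm $\log g_0$, such that on $[\underline k,\overline k]$ $$|\log g_0-\log g_0^*|\le\delta,\qquad |g_0-g_0^*|\le\delta,\qquad |g_0'(k)-(g_0^*)'(k)|\le\delta ,$$ where $\log g_0^*(k)=\log w^*(0,k)$. Put $$p_0(k)=\partial_k\Big(\frac{\log g_0(k)}{k^2}\Big),\quad p_1(k)=\partial_k\Big[\frac{2i}{k}\Big(1-\frac1{g_0(k)}\Big)\Big],\quad m(x,k)=(x^2-1)^2p_0(k)+x(x^2-1)^2p_1(k).$$ *Approximate tail.* Let $V$ be the minimizer of $\tfrac12\big(\|V''\|^2_{L^2(0,1)}+\delta^2\|V\|^2_{H^3(0,1)}\big)$ over all complex-valued $V\in H^3(0,1)$ with $$V(0)=\frac{\log g_0(\overline k)}{\overline k^2},\qquad V'(0)=\frac{i}{\overline k}\Big(1-\frac1{g_0(\overline k)}\Big),\qquad V'(1)=0 .$$ *Functional.* Let $H$ be the real Hilbert space of complex-valued functions $p(x,k)$ on $(0,1)\times(\underline k,\overline k)$ (identified with pairs $(\mathrm{Re}\,p,\mathrm{Im}\,p)$) with $p(0,k)=p'(0,k)=p'(1,k)=0$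 and $\|p\|_H^2=\int_{\underline k}^{\overline k}\|p(\cdot,k)\|^2_{H^2(0,1)}dk<\infty$; let $[\cdot,\cdot]$ be its scalar product and $\overline{B(R)}$ its closed ball of radius $R$ about $0$. For $p\in H$ and $\lambda>0$ put $$S=-\int_k^{\overline k}(p'+m')(x,\tau)\,d\tau+V'(x),$$ $$L(p)=p''+m''-2ik(p'+m')+2k^2(p'+m')S-2iS+2kS^2,$$ $$J_\lambda(p)=e^{2\lambda}\int_{\underline k}^{\overline k}\int_0^1|L(p)(x,k)|^2e^{-2\lambda x}\,dx\,dk .$$ **Theorem.** For each $M$ and each function $r^*$ there is a number $\lambda_0>1$, depending only on $r^*,\underline k,\overline k,M,R$ (and on the fixed $x_0$), such that for all $c^*$, $\delta$, $g_0$, $\log g_0$, $V$ as above with this $r^*$ and with $\max_{[\underline k,\overline k]}|p_1|\le M$, and for every $\lambda\ge\lambda_0$: the functional $J_\lambda$ has a unique minimizer $p_{\min,\lambda}$ on $\overline{B(R)}$. Furthermore $J_\lambda$ is Fréchet differentiable at $p_{\min,\lambda}$ and its gradient $J_\lambda'(p_{\min,\lambda})\in H$ satisfies $$[J_\lambda'(p_{\min,\lambda}),\,y-p_{\min,\lambda}]\ge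 0\qquad\text{for all } y\in\overline{B(R)} .$$ -/

import Mathlib

open Set Filter Topology MeasureTheory
open scoped ContDiff InnerProductSpace

noncomputable section

namespace CWF

/-! ### The forward problem -/

/-- Admissible dielectric constants: `c ∈ C²(ℝ)`, `c ≥ 1`, and `c = 1` outside `(0,1)`. -/
structure IsMedium (c : ℝ → ℝ) : Prop where
  contDiff : ContDiff ℝ 2 c
  one_le : ∀ x, 1 ≤ c x
  eq_one : ∀ x, x ∉ Ioo (0 : ℝ) 1 → c x = 1

/-- `u` solves `u'' + k² c(x) u = -δ(x - x₀)` on `ℝ` with the radiation conditions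
`u' + iku → 0` at `+∞` and `u' - iku → 0` at `-∞`. The point source means: `u` is continuous,
solves the homogeneous equation off `x₀`, and `u'` jumps by `-1` at `x₀`. -/
structure IsForwardSolution (c : ℝ → ℝ) (x₀ k : ℝ) (u : ℝ → ℂ) : Prop where
  continuous : Continuous u
  differentiableAt : ∀ x, x ≠ x₀ → DifferentiableAt ℝ u x
  ode : ∀ x, x ≠ x₀ → HasDerivAt (deriv u) (-((k : ℂ) ^ 2 * (c x : ℂ) * u x)) x
  jump : ∃ a : ℂ, Tendsto (deriv u) (𝓝[<] x₀) (𝓝 a) ∧ Tendsto (deriv u) (𝓝[>] x₀) (𝓝 (a - 1))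
  radiation_top : Tendsto (fun x => deriv u x + Complex.I * k * u x) atTop (𝓝 0)
  radiation_bot : Tendsto (fun x => deriv u x - Complex.I * k * u x) atBot (𝓝 0)

/-- The solution `u₀(x,k) = exp(-ik|x - x₀|) / (2ik)` for `c ≡ 1`. -/
def freeSolution (x₀ x k : ℝ) : ℂ :=
  Complex.exp (-(Complex.I * k * (|x - x₀| : ℝ))) / (2 * Complex.I * k)

/-- The normalized field `w = u / u₀`. -/
def normalizedField (x₀ : ℝ) (u : ℝ → ℝ → ℂ) (x k : ℝ) : ℂ :=
  u x k / freeSolution x₀ x k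

/-- `ψ(x,k) = log w(x,k)` for `x ∈ [0,1]`, `k > 0`: the logarithm of `w` that is continuous in
`k ∈ (0,∞)` and whose branch is fixed by the high-frequency asymptotics
`log w(x,k) = -¼ ln c(x) - ik (∫_{x₀}^x √c dξ - x + x₀) + o(1)` as `k → ∞`.
(These conditions determine `ψ` uniquely on `[0,1] × (0,∞)`.) -/
structure IsLogField (c : ℝ → ℝ) (x₀ : ℝ) (w ψ : ℝ → ℝ → ℂ) : Prop where
  exp_eq : ∀ x ∈ Icc (0 : ℝ) 1, ∀ k, 0 < k → Complex.exp (ψ x k) = w x k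
  continuousOn : ∀ x ∈ Icc (0 : ℝ) 1, ContinuousOn (ψ x) (Ioi 0)
  asymptotics : ∀ x ∈ Icc (0 : ℝ) 1,
    Tendsto (fun k : ℝ => ψ x k - (-((Real.log (c x) / 4 : ℝ) : ℂ)
      - Complex.I * k * (((∫ ξ in x₀..x, √(c ξ)) - x + x₀ : ℝ) : ℂ))) atTop (𝓝 0)

/-! ### Boundary data -/

/-- Measured data on `[kl, ku]`: `g₀` is `C¹` and `ℓ = log g₀` is a continuous logarithm of it
(so `g₀` does not vanish). -/
structure IsData (kl ku : ℝ) (g₀ ℓ : ℝ → ℂ) : Prop where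
  contDiffOn : ContDiffOn ℝ 1 g₀ (Icc kl ku)
  continuousOn_log : ContinuousOn ℓ (Icc kl ku)
  exp_eq : ∀ k ∈ Icc kl ku, Complex.exp (ℓ k) = g₀ k

/-- Noise level `δ`: `|log g₀ - log g₀*| ≤ δ`, `|g₀ - g₀*| ≤ δ`, `|g₀' - (g₀*)'| ≤ δ` on `[kl, ku]`.
Here `gs = g₀*` and `ℓs = log g₀*` are defined for all `k > 0`. -/
def NoiseBound (kl ku δ : ℝ) (g₀ ℓ gs ℓs : ℝ → ℂ) : Prop :=
  ∀ k ∈ Icc kl ku, ‖ℓ k - ℓs k‖ ≤ δ ∧ ‖g₀ k - gs k‖ ≤ δ ∧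
    ‖derivWithin g₀ (Icc kl ku) k - deriv gs k‖ ≤ δ

/-- `p₀(k) = ∂ₖ (log g₀(k) / k²)` on `[kl, ku]`. -/
def bdry₀ (kl ku : ℝ) (ℓ : ℝ → ℂ) (k : ℝ) : ℂ :=
  derivWithin (fun s : ℝ => ℓ s / (s : ℂ) ^ 2) (Icc kl ku) k

/-- `p₁(k) = ∂ₖ [(2i/k) (1 - 1/g₀(k))]` on `[kl, ku]`. -/
def bdry₁ (kl ku : ℝ) (g₀ : ℝ → ℂ) (k : ℝ) : ℂ :=
  derivWithin (fun s : ℝ => 2 * Complex.I / (s : ℂ) * (1 - 1 / g₀ s)) (Icc kl ku) k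

/-! ### Sobolev spaces on `(0,1)` -/

/-- Complex-valued `L²(0,1)`; below it is used as a real Hilbert space, i.e. a function is
identified with the pair (real part, imaginary part). -/
abbrev L2I : Type := Lp ℂ 2 (volume.restrict (Ioo (0 : ℝ) 1))

/-- `g` is the weak derivative of `f` on `(0,1)`. -/
def IsWeakDeriv (f g : L2I) : Prop :=
  ∀ φ : ℝ → ℝ, ContDiff ℝ ∞ φ → HasCompactSupport φ → tsupport φ ⊆ Ioo 0 1 →
    ∫ x in Ioo (0 : ℝ) 1, deriv φ x • f x = -∫ x in Ioo (0 : ℝ) 1, φ x • g x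

theorem integrable_smul_L2I {φ : ℝ → ℝ} (hφ : Continuous φ) (hs : HasCompactSupport φ)
    (f : L2I) : Integrable (fun x => φ x • f x) (volume.restrict (Ioo (0 : ℝ) 1)) := by
  obtain ⟨C, hC⟩ := hs.exists_bound_of_continuous hφ
  have hf : Integrable f (volume.restrict (Ioo (0 : ℝ) 1)) :=
    (Lp.memLp f).integrable (by norm_num)
  exact hf.bdd_smul C hφ.aestronglyMeasurable (ae_of_all _ hC)

theorem IsWeakDeriv.add {f g f' g' : L2I} (h : IsWeakDeriv f f') (h' : IsWeakDeriv g g') :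
    IsWeakDeriv (f + g) (f' + g') := by
  intro φ hφ hc hs
  have hd : Continuous (deriv φ) := hφ.continuous_deriv (by simp)
  have e1 : ∫ x in Ioo (0 : ℝ) 1, deriv φ x • (f + g) x
      = ∫ x in Ioo (0 : ℝ) 1, (deriv φ x • f x + deriv φ x • g x) :=
    integral_congr_ae <| by
      filter_upwards [Lp.coeFn_add f g] with x hx
      simp only [hx, Pi.add_apply, smul_add]
  have e2 : ∫ x in Ioo (0 : ℝ) 1, φ x • (f' + g') x
      = ∫ x in Ioo (0 : ℝ) 1, (φ x • f' x + φ x • g' x) :=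
    integral_congr_ae <| by
      filter_upwards [Lp.coeFn_add f' g'] with x hx
      simp only [hx, Pi.add_apply, smul_add]
  rw [e1, e2, integral_add (integrable_smul_L2I hd hc.deriv f) (integrable_smul_L2I hd hc.deriv g),
    integral_add (integrable_smul_L2I hφ.continuous hc f')
      (integrable_smul_L2I hφ.continuous hc g'), h φ hφ hc hs, h' φ hφ hc hs, neg_add]

theorem IsWeakDeriv.smul {f f' : L2I} (a : ℝ) (h : IsWeakDeriv f f') :
    IsWeakDeriv (a • f) (a • f') := by
  intro φ hφ hc hs
  have e1 : ∫ x in Ioo (0 : ℝ) 1, deriv φ x • (a • f) x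
      = ∫ x in Ioo (0 : ℝ) 1, a • (deriv φ x • f x) :=
    integral_congr_ae <| by
      filter_upwards [Lp.coeFn_smul a f] with x hx
      simp only [hx, Pi.smul_apply, smul_comm a]
  have e2 : ∫ x in Ioo (0 : ℝ) 1, φ x • (a • f') x
      = ∫ x in Ioo (0 : ℝ) 1, a • (φ x • f' x) :=
    integral_congr_ae <| by
      filter_upwards [Lp.coeFn_smul a f'] with x hx
      simp only [hx, Pi.smul_apply, smul_comm a]
  rw [e1, e2, integral_smul, integral_smul, h φ hφ hc hs, smul_neg]

theorem IsWeakDeriv.zero : IsWeakDeriv 0 0 := by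
  intro φ hφ hc hs
  have e : ∀ θ : ℝ → ℝ, ∫ x in Ioo (0 : ℝ) 1, θ x • (0 : L2I) x = 0 := fun θ => by
    rw [integral_congr_ae (g := fun _ => (0 : ℂ)), integral_zero]
    filter_upwards [Lp.coeFn_zero ℂ 2 (volume.restrict (Ioo (0 : ℝ) 1))] with x hx
    simp only [hx, Pi.zero_apply, smul_zero]
  rw [e, e, neg_zero]

/-- The Sobolev space `Hⁿ(0,1)`: its elements are the tuples `(f, f', …, f⁽ⁿ⁾)` of `L²` functions,
each the weak derivative of the preceding one, with
`‖f‖² = ‖f‖²_{L²} + ‖f'‖²_{L²} + … + ‖f⁽ⁿ⁾‖²_{L²}`. -/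
def Sobolev (n : ℕ) : Submodule ℝ (PiLp 2 fun _ : Fin (n + 1) => L2I) where
  carrier := {U | ∀ j : Fin n, IsWeakDeriv (U j.castSucc) (U j.succ)}
  add_mem' hU hV j := (hU j).add (hV j)
  zero_mem' _ := IsWeakDeriv.zero
  smul_mem' a _ hU j := (hU j).smul a

/-- The `L²` function `f` has a representative that is continuous on `[0,1]` and takes the
value `v` at `a ∈ [0,1]`. -/
def HasValueAt (f : L2I) (a : ℝ) (v : ℂ) : Prop :=
  ∃ F : ℝ → ℂ, ContinuousOn F (Icc 0 1) ∧ f =ᵐ[volume.restrict (Ioo (0 : ℝ) 1)] F ∧ F a = v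

theorem HasValueAt.add {f g : L2I} {a : ℝ} {v w : ℂ} (hf : HasValueAt f a v)
    (hg : HasValueAt g a w) : HasValueAt (f + g) a (v + w) := by
  obtain ⟨F, hF, hfF, rfl⟩ := hf
  obtain ⟨G, hG, hgG, rfl⟩ := hg
  exact ⟨F + G, hF.add hG, (Lp.coeFn_add f g).trans (hfF.add hgG), rfl⟩

theorem HasValueAt.smul {f : L2I} {a : ℝ} {v : ℂ} (b : ℝ) (hf : HasValueAt f a v) :
    HasValueAt (b • f) a (b • v) := by
  obtain ⟨F, hF, hfF, rfl⟩ := hf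
  exact ⟨b • F, hF.const_smul b, (Lp.coeFn_smul b f).trans (hfF.const_smul b), rfl⟩

theorem HasValueAt.zero (a : ℝ) : HasValueAt 0 a 0 :=
  ⟨0, continuousOn_const, Lp.coeFn_zero _ _ _, rfl⟩

/-- The continuous representative on `[0,1]` of an `L²` function that has one (in particular of
every function in `H¹(0,1)`); its values on `[0,1]` are determined by `f`. -/
def contRep (f : L2I) : ℝ → ℂ :=
  open Classical in
  if h : ∃ F : ℝ → ℂ, ContinuousOn F (Icc 0 1) ∧ f =ᵐ[volume.restrict (Ioo (0 : ℝ) 1)] F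
  then h.choose else 0

/-- The space of all `f ∈ H²(0,1)` with `f(0) = f'(0) = f'(1) = 0`, with the norm of `H²(0,1)`. -/
def H2Zero : Submodule ℝ (Sobolev 2) where
  carrier := {U | HasValueAt (U.1 0) 0 0 ∧ HasValueAt (U.1 1) 0 0 ∧ HasValueAt (U.1 1) 1 0}
  add_mem' hU hV := ⟨by simpa using hU.1.add hV.1, by simpa using hU.2.1.add hV.2.1,
    by simpa using hU.2.2.add hV.2.2⟩
  zero_mem' := ⟨.zero 0, .zero 0, .zero 1⟩
  smul_mem' a _ hU := ⟨by simpa using hU.1.smul a, by simpa using hU.2.1.smul a,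
    by simpa using hU.2.2.smul a⟩

/-- `H2Zero` as a type of its own, with the inner product of `H²(0,1)`. -/
def H2Space : Type := H2Zero

instance : NormedAddCommGroup H2Space := inferInstanceAs (NormedAddCommGroup H2Zero)

instance : InnerProductSpace ℝ H2Space := inferInstanceAs (InnerProductSpace ℝ H2Zero)

/-- The `j`-th derivative `f⁽ʲ⁾ ∈ L²(0,1)`, `j = 0, 1, 2`, of `f ∈ H²(0,1)`. -/
def H2Space.D (f : H2Space) (j : Fin 3) : L2I := f.1.1 j

/-- The real Hilbert space `H` of functions `p(x,k)`, `(x,k) ∈ (0,1) × (kl,ku)`, with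
`p(0,k) = p'(0,k) = p'(1,k) = 0` and `‖p‖² = ∫_{kl}^{ku} ‖p(·,k)‖²_{H²(0,1)} dk < ∞`. -/
abbrev HSpace (kl ku : ℝ) : Type := Lp H2Space 2 (volume.restrict (Ioo kl ku))

/-! ### The tail function -/

/-- The affine set `W` of all `V ∈ H³(0,1)` with `V(0) = log g₀(k̄)/k̄²`,
`V'(0) = (i/k̄)(1 - 1/g₀(k̄))`, `V'(1) = 0`; here `ku = k̄`. -/
def tailSet (ku : ℝ) (g₀ ℓ : ℝ → ℂ) : Set (Sobolev 3) :=
  {V | HasValueAt (V.1 0) 0 (ℓ ku / (ku : ℂ) ^ 2) ∧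
    HasValueAt (V.1 1) 0 (Complex.I / (ku : ℂ) * (1 - 1 / g₀ ku)) ∧ HasValueAt (V.1 1) 1 0}

/-- The quasi-reversibility functional `½ (‖V''‖²_{L²(0,1)} + α ‖V‖²_{H³(0,1)})`. -/
def tailFunctional (α : ℝ) (V : Sobolev 3) : ℝ :=
  (‖V.1 2‖ ^ 2 + α * ‖V‖ ^ 2) / 2

/-- `V` minimizes the quasi-reversibility functional with parameter `α` on `W`. -/
def IsTail (ku α : ℝ) (g₀ ℓ : ℝ → ℂ) (V : Sobolev 3) : Prop :=
  V ∈ tailSet ku g₀ ℓ ∧ IsMinOn (tailFunctional α) (tailSet ku g₀ ℓ) V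

/-! ### The weighted cost functional -/

/-- `m(x,k) = (x² - 1)² p₀(k) + x (x² - 1)² p₁(k)`. -/
def mFun (p₀ p₁ : ℝ → ℂ) (x k : ℝ) : ℂ :=
  ((x : ℂ) ^ 2 - 1) ^ 2 * p₀ k + (x : ℂ) * ((x : ℂ) ^ 2 - 1) ^ 2 * p₁ k

variable {kl ku : ℝ}

/-- `p'(x,k) + m'(x,k)`, derivatives in `x`. -/
def dq (p₀ p₁ : ℝ → ℂ) (p : HSpace kl ku) (x k : ℝ) : ℂ :=
  contRep ((p k).D 1) x + deriv (fun y => mFun p₀ p₁ y k) x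

/-- `-∫_k^{k̄} (p' + m')(x,τ) dτ + V'(x)`; here `ku = k̄`. -/
def dv (p₀ p₁ : ℝ → ℂ) (V : Sobolev 3) (p : HSpace kl ku) (x k : ℝ) : ℂ :=
  -(∫ τ in k..ku, dq p₀ p₁ p x τ) + contRep (V.1 1) x

/-- The nonlinear integro-differential operator `L(p)(x,k)`. -/
def opL (p₀ p₁ : ℝ → ℂ) (V : Sobolev 3) (p : HSpace kl ku) (x k : ℝ) : ℂ :=
  (p k).D 2 x + iteratedDeriv 2 (fun y => mFun p₀ p₁ y k) x
    - 2 * Complex.I * k * dq p₀ p₁ p x k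
    + 2 * (k : ℂ) ^ 2 * dq p₀ p₁ p x k * dv p₀ p₁ V p x k
    - 2 * Complex.I * dv p₀ p₁ V p x k
    + 2 * k * dv p₀ p₁ V p x k ^ 2

/-- The weighted cost functional
`J_λ(p) = e^{2λ} ∫_{kl}^{ku} ∫_0^1 |L(p)(x,k)|² e^{-2λx} dx dk`. -/
def costJ (p₀ p₁ : ℝ → ℂ) (V : Sobolev 3) (lam : ℝ) (p : HSpace kl ku) : ℝ :=
  Real.exp (2 * lam) * ∫ k in Ioo kl ku, ∫ x in Ioo (0 : ℝ) 1,
    ‖opL p₀ p₁ V p x k‖ ^ 2 * Real.exp (-(2 * lam * x))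

end CWF

end

open CWF

/-! Up to the factor e^{2λ}, J_λ(p) is the squared norm of e^{-λx} L(p) in L²((kl,ku); L²(0,1)), and
L(p) is p'' plus lower order terms, of degree at most two in q = p' + m' and S. The theorem is
strong convexity of J_λ on the ball for large λ. A minimizing sequence is then Cauchy by the
midpoint inequality, so existence, uniqueness and the variational inequality need no weak
compactness (`exists_unique_isMinOn_of_strongly_convex`).

Strong convexity rests on a one-dimensional Carleman estimate (`norm_weightC_mul_prim_le`): because
p'(0) = 0, the supremum over x of e^{-λx}|p'| is at most (2λ)^{-1/2} times the L² norm of e^{-λx}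
p''. The weight does not depend on k, so it commutes with the integral in S and with every product.
Replacing p by p + h changes L(p) by h'' plus terms each containing h' or its k-integral; these are
small against e^{-λx} h'' in the weighted norm. In the expansion of the square the only term without
a sign is the product of L(p) with the part quadratic in h. There both copies of the weight are
moved to the quadratic part, one onto each factor h, so this term is small against the square of the
weighted norm of h''. `QuadOp.weighted_convexity` carries this out abstractly, and `quadL` and
`quadL_weight` supply the concrete spaces: q lies in L²(C[0,1]), S in L^∞(C[0,1]).

The threshold for λ must not depend on c*, δ, g₀ or V, so p₀, p₁ and V' need uniform bounds. For p₁
this is M. The value r*(0) bounds log g₀ at the endpoint ku. Energy conservation for the Helmholtz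
equation gives |g₀*| ≤ 2, hence |g₀| ≤ 3, and with this p₁ controls the derivative of log g₀ and
therefore p₀ (`exists_bdry₀_bound`). Finally V' is bounded by comparing V with an explicit quadratic
polynomial (`exists_tail_deriv_bound`). -/

noncomputable section

/-! ### Minimization of strongly convex functionals on a Hilbert space -/

/-- A nonnegative differentiable functional that is strongly convex on a nonempty closed convex set
of a Hilbert space has a unique minimizer there, characterised by a variational inequality. -/
theorem exists_unique_isMinOn_of_strongly_convex {X : Type*} [NormedAddCommGroup X]
    [InnerProductSpace ℝ X] [CompleteSpace X] {J : X → ℝ} {J' : X → X →L[ℝ] ℝ} {s : Set X}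
    (hs : Convex ℝ s) (hcl : IsClosed s) (hne : s.Nonempty) {c : ℝ} (hc : 0 < c)
    (hpos : ∀ p, 0 ≤ J p) (hJ : ∀ p, HasFDerivAt J (J' p) p)
    (hconv : ∀ p ∈ s, ∀ q ∈ s, J p + J' p (q - p) + c * ‖q - p‖ ^ 2 ≤ J q) :
    ∃ pmin ∈ s, IsMinOn J s pmin ∧ (∀ q ∈ s, IsMinOn J s q → q = pmin) ∧
      ∃ g : X, HasFDerivAt J (innerSL ℝ g) pmin ∧ ∀ y ∈ s, 0 ≤ ⟪g, y - pmin⟫_ℝ := by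
  -- Strong convexity is used at the midpoint towards both ends; the two derivative terms cancel.
  -- Along a minimizing sequence this bounds the distance of two members by their excess over the
  -- infimum.
  have hmid : ∀ p ∈ s, ∀ q ∈ s, ∃ z ∈ s, 2 * J z + c / 2 * ‖p - q‖ ^ 2 ≤ J p + J q := by
    intro p hp q hq
    have hz : (1 / 2 : ℝ) • p + (1 / 2 : ℝ) • q ∈ s :=
      hs hp hq (by norm_num) (by norm_num) (by norm_num)
    refine ⟨_, hz, ?_⟩
    have h1 := hconv _ hz p hp
    have h2 := hconv _ hz q hq
    have e1 : p - ((1 / 2 : ℝ) • p + (1 / 2 : ℝ) • q) = (1 / 2 : ℝ) • (p - q) := by module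
    have e2 : q - ((1 / 2 : ℝ) • p + (1 / 2 : ℝ) • q) = -((1 / 2 : ℝ) • (p - q)) := by module
    rw [e1] at h1
    rw [e2, map_neg, norm_neg] at h2
    have e3 : ‖(1 / 2 : ℝ) • (p - q)‖ ^ 2 = ‖p - q‖ ^ 2 / 4 := by
      rw [norm_smul, mul_pow]; norm_num; ring
    rw [e3] at h1 h2
    linarith
  have hbdd : BddBelow (J '' s) := ⟨0, by rintro _ ⟨p, -, rfl⟩; exact hpos p⟩
  set I := sInf (J '' s) with hI
  have hIle : ∀ p ∈ s, I ≤ J p := fun p hp => csInf_le hbdd (mem_image_of_mem J hp)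
  have hex : ∀ n : ℕ, ∃ p ∈ s, J p < I + 1 / ((n : ℝ) + 1) := by
    intro n
    obtain ⟨_, ⟨p, hp, rfl⟩, h⟩ := exists_lt_of_csInf_lt (hne.image J)
      (lt_add_of_pos_right I (Nat.one_div_pos_of_nat (n := n) (α := ℝ)))
    exact ⟨p, hp, h⟩
  choose a has ha using hex
  have hlim : Tendsto (fun n : ℕ => 1 / ((n : ℝ) + 1)) atTop (𝓝 0) :=
    tendsto_one_div_add_atTop_nhds_zero_nat
  have hcauchy : CauchySeq a := by
    refine Metric.cauchySeq_iff'.2 fun ε hε => ?_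
    have hev : ∀ᶠ n : ℕ in atTop, 1 / ((n : ℝ) + 1) < c / 4 * ε ^ 2 :=
      hlim.eventually_lt_const (by positivity)
    obtain ⟨N, hN⟩ := hev.exists_forall_of_atTop
    refine ⟨N, fun n hn => ?_⟩
    obtain ⟨z, hz, hzle⟩ := hmid _ (has n) _ (has N)
    have h1 := hIle z hz
    have h2 := ha n
    have h3 := ha N
    have h4 := hN n hn
    have h5 := hN N le_rfl
    rw [dist_eq_norm]
    have h6 : ‖a n - a N‖ ^ 2 < ε ^ 2 := by
      by_contra! hcon
      have := mul_le_mul_of_nonneg_left hcon (half_pos hc).le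
      linarith
    exact lt_of_pow_lt_pow_left₀ 2 hε.le h6
  obtain ⟨p, hp⟩ := cauchySeq_tendsto_of_complete hcauchy
  have hps : p ∈ s := hcl.mem_of_tendsto hp (Eventually.of_forall has)
  have hJp : J p ≤ I := by
    have t1 : Tendsto (fun n => J (a n)) atTop (𝓝 (J p)) :=
      ((hJ p).continuousAt.tendsto).comp hp
    have t2 : Tendsto (fun n : ℕ => I + 1 / ((n : ℝ) + 1)) atTop (𝓝 (I + 0)) := hlim.const_add I
    rw [add_zero] at t2
    exact le_of_tendsto_of_tendsto' t1 t2 fun n => (ha n).le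
  have hmin : IsMinOn J s p := fun q hq => hJp.trans (hIle q hq)
  have hvar : ∀ y ∈ s, 0 ≤ J' p (y - p) := fun y hy =>
    hmin.localize.hasFDerivWithinAt_nonneg (hJ p).hasFDerivWithinAt
      (sub_mem_posTangentConeAt_of_segment_subset (hs.segment_subset hps hy))
  refine ⟨p, hps, hmin, fun q hq hqm => ?_, (InnerProductSpace.toDual ℝ X).symm (J' p), ?_, ?_⟩
  · have h1 := hconv p hps q hq
    have h2 := hvar q hq
    have h3 : J q ≤ J p := hqm hps
    have h4 : ‖q - p‖ ^ 2 ≤ 0 := by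
      by_contra! hcon
      have := mul_pos hc hcon
      linarith
    have h5 : ‖q - p‖ = 0 := by
      have := sq_nonneg ‖q - p‖
      exact pow_eq_zero_iff (two_ne_zero) |>.1 (le_antisymm h4 this)
    exact sub_eq_zero.1 (norm_eq_zero.1 h5)
  · have : innerSL ℝ ((InnerProductSpace.toDual ℝ X).symm (J' p)) = J' p := by
      ext h
      simp
    rw [this]
    exact hJ p
  · intro y hy
    rw [InnerProductSpace.toDual_symm_apply]
    exact hvar y hy

/-! ### Weighted quadratic functionals -/

/-- The data of a quadratic operator
`p ↦ D p + d₀ + ι (q α + q β s + j(s) γ + j(s) η s)` with `q = T p + q₀` and `s = σ (T p) + s₀`. -/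
structure QuadOp (X Y Z A : Type*) [NormedAddCommGroup X] [InnerProductSpace ℝ X]
    [NormedAddCommGroup Y] [InnerProductSpace ℝ Y] [NormedAddCommGroup Z] [NormedSpace ℝ Z]
    [NormedAddCommGroup A] [NormedSpace ℝ A] where
  /-- principal part -/
  D : X →L[ℝ] Y
  /-- lower order part -/
  T : X →L[ℝ] Z
  /-- integral operator -/
  σ : Z →L[ℝ] A
  /-- inclusion of the bounded coefficients -/
  j : A →L[ℝ] Z
  /-- inclusion into the target space -/
  ι : Z →L[ℝ] Y
  /-- multiplication -/
  m : Z →L[ℝ] A →L[ℝ] Z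
  /-- coefficient of the linear term in `q` -/
  α : A
  /-- coefficient of the product `q s` -/
  β : A
  /-- coefficient of the linear term in `s` -/
  γ : A
  /-- coefficient of the square of `s` -/
  η : A

namespace QuadOp

variable {X Y Z A : Type*} [NormedAddCommGroup X] [InnerProductSpace ℝ X]
    [NormedAddCommGroup Y] [InnerProductSpace ℝ Y] [NormedAddCommGroup Z] [NormedSpace ℝ Z]
    [NormedAddCommGroup A] [NormedSpace ℝ A] (S : QuadOp X Y Z A)

/-- The nonlinearity `q α + q β s + j(s) γ + j(s) η s`. -/
def N (q : Z) (s : A) : Z :=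
  S.m q S.α + S.m (S.m q S.β) s + S.m (S.j s) S.γ + S.m (S.m (S.j s) S.η) s

/-- The differential of `N` at `(q, s)`. -/
def NL (q : Z) (s : A) (h : Z) (t : A) : Z :=
  S.m h S.α + S.m (S.m h S.β) s + S.m (S.m q S.β) t + S.m (S.j t) S.γ + S.m (S.m (S.j t) S.η) s
    + S.m (S.m (S.j s) S.η) t

/-- The quadratic part of `N`. -/
def NQ (h : Z) (t : A) : Z := S.m (S.m h S.β) t + S.m (S.m (S.j t) S.η) t

/-- Built from bilinear maps, `N` has degree at most two, so this expansion is exact and leaves no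
Taylor remainder to estimate. -/
theorem N_add (q : Z) (s : A) (h : Z) (t : A) :
    S.N (q + h) (s + t) = S.N q s + S.NL q s h t + S.NQ h t := by
  simp only [N, NL, NQ, map_add, _root_.add_apply]
  abel

/-- The quadratic operator. -/
def op (d₀ : Y) (q₀ : Z) (s₀ : A) (p : X) : Y :=
  S.D p + d₀ + S.ι (S.N (S.T p + q₀) (S.σ (S.T p) + s₀))

theorem op_add (d₀ : Y) (q₀ : Z) (s₀ : A) (p h : X) :
    S.op d₀ q₀ s₀ (p + h) = S.op d₀ q₀ s₀ p
      + (S.D h + S.ι (S.NL (S.T p + q₀) (S.σ (S.T p) + s₀) (S.T h) (S.σ (S.T h))))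
      + S.ι (S.NQ (S.T h) (S.σ (S.T h))) := by
  have e1 : S.T (p + h) + q₀ = (S.T p + q₀) + S.T h := by rw [map_add]; abel
  have e2 : S.σ (S.T (p + h)) + s₀ = (S.σ (S.T p) + s₀) + S.σ (S.T h) := by
    rw [map_add, map_add]; abel
  simp only [op]
  rw [e1, e2, N_add]
  simp only [map_add]
  abel

theorem exists_hasFDerivAt_op (d₀ : Y) (q₀ : Z) (s₀ : A) (p : X) :
    ∃ Φ' : X →L[ℝ] Y, HasFDerivAt (S.op d₀ q₀ s₀) Φ' p ∧
      ∀ h, Φ' h = S.D h + S.ι (S.NL (S.T p + q₀) (S.σ (S.T p) + s₀) (S.T h) (S.σ (S.T h))) := by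
  have hq : HasFDerivAt (fun p => S.T p + q₀) S.T p := S.T.hasFDerivAt.add_const q₀
  have hs : HasFDerivAt (fun p => S.σ (S.T p) + s₀) (S.σ.comp S.T) p :=
    ((S.σ.comp S.T).hasFDerivAt (x := p)).add_const s₀
  have hjs := S.j.hasFDerivAt.comp p hs
  have h1 := ((S.m.flip S.α).hasFDerivAt).comp p hq
  have h2 := ((S.m.hasFDerivAt).comp p (((S.m.flip S.β).hasFDerivAt).comp p hq)).clm_apply hs
  have h3 := ((S.m.flip S.γ).hasFDerivAt).comp p hjs
  have h4 := ((S.m.hasFDerivAt).comp p (((S.m.flip S.η).hasFDerivAt).comp p hjs)).clm_apply hs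
  have h5 := (S.ι.hasFDerivAt).comp p (((h1.add h2).add h3).add h4)
  refine ⟨_, ((S.D.hasFDerivAt (x := p)).add_const d₀).add h5, fun h => ?_⟩
  simp only [NL, _root_.add_apply, ContinuousLinearMap.comp_apply,
    ContinuousLinearMap.flip_apply, Function.comp_apply, map_add]
  abel

/-- All the norms that enter the estimates are at most `K`. -/
structure Bounded (K : ℝ) : Prop where
  one_le : 1 ≤ K
  D : ∀ p, ‖S.D p‖ ≤ K * ‖p‖
  T : ∀ p, ‖S.T p‖ ≤ K * ‖p‖
  σ : ∀ z, ‖S.σ z‖ ≤ K * ‖z‖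
  j : ∀ a, ‖S.j a‖ ≤ K * ‖a‖
  ι : ∀ z, ‖S.ι z‖ ≤ ‖z‖
  m : ∀ z a, ‖S.m z a‖ ≤ ‖z‖ * ‖a‖
  α : ‖S.α‖ ≤ K
  β : ‖S.β‖ ≤ K
  γ : ‖S.γ‖ ≤ K
  η : ‖S.η‖ ≤ K

/-- Multiplication by a weight in all the spaces, for which the lower order part `T` is small with
respect to the principal part `D`. -/
structure Weight (ε : ℝ) (wY : Y →L[ℝ] Y) (wZ : Z → Z) (wA : A → A) : Prop where
  m_left : ∀ z a, wZ (S.m z a) = S.m (wZ z) a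
  m_right : ∀ z a, wZ (S.m z a) = S.m z (wA a)
  add : ∀ z z', wZ (z + z') = wZ z + wZ z'
  j : ∀ a, wZ (S.j a) = S.j (wA a)
  σ : ∀ z, wA (S.σ z) = S.σ (wZ z)
  ι : ∀ z, wY (S.ι z) = S.ι (wZ z)
  symm : ∀ y y', ⟪wY y, wY y'⟫_ℝ = ⟪y, wY (wY y')⟫_ℝ
  T : ∀ h, ‖wZ (S.T h)‖ ≤ ε * ‖wY (S.D h)‖

variable {S} {K ε : ℝ} {wY : Y →L[ℝ] Y} {wZ : Z → Z} {wA : A → A}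

theorem Bounded.norm_m_le (hB : S.Bounded K) {z : Z} {a : A} {x y : ℝ} (hz : ‖z‖ ≤ x)
    (ha : ‖a‖ ≤ y) : ‖S.m z a‖ ≤ x * y :=
  (hB.m z a).trans (mul_le_mul hz ha (norm_nonneg _) ((norm_nonneg _).trans hz))

theorem Bounded.norm_j_le (hB : S.Bounded K) {a : A} {x : ℝ} (ha : ‖a‖ ≤ x) :
    ‖S.j a‖ ≤ K * x :=
  (hB.j a).trans (mul_le_mul_of_nonneg_left ha (zero_le_one.trans hB.one_le))

theorem Bounded.norm_N_le (hB : S.Bounded K) {q : Z} {s : A} {x y : ℝ} (hq : ‖q‖ ≤ x)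
    (hs : ‖s‖ ≤ y) : ‖S.N q s‖ ≤ x * K + x * K * y + K * y * K + K * y * K * y := by
  have hj := hB.norm_j_le hs
  exact (norm_add_le _ _).trans (add_le_add ((norm_add_le _ _).trans (add_le_add
    ((norm_add_le _ _).trans (add_le_add (hB.norm_m_le hq hB.α)
      (hB.norm_m_le (hB.norm_m_le hq hB.β) hs))) (hB.norm_m_le hj hB.γ)))
      (hB.norm_m_le (hB.norm_m_le hj hB.η) hs))

/-- In each product the weight is moved onto an increment, which makes the bound linear in `b`. In
the quadratic terms the other increment keeps its unweighted bound `y'`. -/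
theorem Bounded.norm_weight_NL_add_NQ_le (hB : S.Bounded K) (hW : S.Weight ε wY wZ wA)
    {q h : Z} {s t : A} {x y y' b : ℝ} (hq : ‖q‖ ≤ x) (hs : ‖s‖ ≤ y) (ht : ‖t‖ ≤ y')
    (hh : ‖wZ h‖ ≤ b) (hwt : ‖wA t‖ ≤ K * b) :
    ‖wZ (S.NL q s h t + S.NQ h t)‖ ≤ b * K + b * K * y + x * K * (K * b) + K * (K * b) * K
      + K * (K * b) * K * y + K * y * K * (K * b) + (b * K * y' + K * (K * b) * K * y') := by
  have hj := hB.norm_j_le hs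
  have hjt : ‖wZ (S.j t)‖ ≤ K * (K * b) := by rw [hW.j]; exact hB.norm_j_le hwt
  simp only [NL, NQ, hW.add]
  refine (norm_add_le _ _).trans (add_le_add ((norm_add_le _ _).trans (add_le_add
    ((norm_add_le _ _).trans (add_le_add ((norm_add_le _ _).trans (add_le_add
    ((norm_add_le _ _).trans (add_le_add ((norm_add_le _ _).trans (add_le_add ?_ ?_)) ?_)) ?_)) ?_))
    ?_)) ((norm_add_le _ _).trans (add_le_add ?_ ?_)))
  · rw [hW.m_left]; exact hB.norm_m_le hh hB.α
  · rw [hW.m_left, hW.m_left]; exact hB.norm_m_le (hB.norm_m_le hh hB.β) hs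
  · rw [hW.m_right]; exact hB.norm_m_le (hB.norm_m_le hq hB.β) hwt
  · rw [hW.m_left]; exact hB.norm_m_le hjt hB.γ
  · rw [hW.m_left, hW.m_left]; exact hB.norm_m_le (hB.norm_m_le hjt hB.η) hs
  · rw [hW.m_right]; exact hB.norm_m_le (hB.norm_m_le hj hB.η) hwt
  · rw [hW.m_left, hW.m_left]; exact hB.norm_m_le (hB.norm_m_le hh hB.β) ht
  · rw [hW.m_left, hW.m_left]; exact hB.norm_m_le (hB.norm_m_le hjt hB.η) ht

/-- Each product in `NQ` contains two increments, and each absorbs one copy of the weight; hence the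
bound is quadratic in `b`. -/
theorem Bounded.norm_weight_weight_NQ_le (hB : S.Bounded K) (hW : S.Weight ε wY wZ wA)
    {h : Z} {t : A} {b : ℝ} (hh : ‖wZ h‖ ≤ b) (hwt : ‖wA t‖ ≤ K * b) :
    ‖wZ (wZ (S.NQ h t))‖ ≤ b * K * (K * b) + K * (K * b) * K * (K * b) := by
  have hjt : ‖wZ (S.j t)‖ ≤ K * (K * b) := by rw [hW.j]; exact hB.norm_j_le hwt
  simp only [NQ, hW.add]
  refine (norm_add_le _ _).trans (add_le_add ?_ ?_)
  · rw [hW.m_left, hW.m_right (wZ _) t, hW.m_left]; exact hB.norm_m_le (hB.norm_m_le hh hB.β) hwt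
  · rw [hW.m_left, hW.m_right (wZ _) t, hW.m_left]; exact hB.norm_m_le (hB.norm_m_le hjt hB.η) hwt

set_option maxHeartbeats 1000000 in
/-- Strong convexity of `p ↦ ‖wY (op p)‖²` on the ball of radius `K`. -/
theorem weighted_convexity (hB : S.Bounded K) (hW : S.Weight ε wY wZ wA) (hε : 0 ≤ ε)
    (hεK : 56 * K ^ 6 * ε ≤ 1) {d₀ : Y} {q₀ : Z} {s₀ : A} (hd₀ : ‖d₀‖ ≤ K) (hq₀ : ‖q₀‖ ≤ K)
    (hs₀ : ‖s₀‖ ≤ K) {p h : X} (hp : ‖p‖ ≤ K) (hh : ‖h‖ ≤ 2 * K) :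
    ‖wY (S.op d₀ q₀ s₀ p)‖ ^ 2
      + 2 * ⟪wY (S.op d₀ q₀ s₀ p), wY (S.D h
        + S.ι (S.NL (S.T p + q₀) (S.σ (S.T p) + s₀) (S.T h) (S.σ (S.T h))))⟫_ℝ
      + ‖wY (S.D h)‖ ^ 2 / 2 ≤ ‖wY (S.op d₀ q₀ s₀ (p + h))‖ ^ 2 := by
  have hK := hB.one_le
  have hK0 : 0 ≤ K := zero_le_one.trans hK
  set q := S.T p + q₀ with hq
  set s := S.σ (S.T p) + s₀ with hs
  set h' := S.T h with hh'
  set t := S.σ h' with ht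
  set b := ‖wY (S.D h)‖ with hb
  have hb0 : 0 ≤ b := norm_nonneg _
  have pw : ∀ {m n : ℕ}, m ≤ n → K ^ m ≤ K ^ n := fun hmn => pow_le_pow_right₀ hK hmn
  have p12 := pw (show 1 ≤ 2 by norm_num)
  have p13 := pw (show 1 ≤ 3 by norm_num)
  have nT : ‖S.T p‖ ≤ K * K := (hB.T p).trans (mul_le_mul_of_nonneg_left hp hK0)
  have nq : ‖q‖ ≤ 2 * K ^ 2 := (norm_add_le _ _).trans (by linarith [pow_one K, sq K])
  have nσ : ‖S.σ (S.T p)‖ ≤ K * (K * K) := (hB.σ _).trans (mul_le_mul_of_nonneg_left nT hK0)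
  have ns : ‖s‖ ≤ 2 * K ^ 3 := (norm_add_le _ _).trans (by
    linarith [pow_one K, show K * (K * K) = K ^ 3 by ring])
  have nh' : ‖h'‖ ≤ K * (2 * K) := (hB.T h).trans (mul_le_mul_of_nonneg_left hh hK0)
  have nt : ‖t‖ ≤ 2 * K ^ 3 :=
    (hB.σ _).trans ((mul_le_mul_of_nonneg_left nh' hK0).trans_eq (by ring))
  have nwh : ‖wZ h'‖ ≤ ε * b := hW.T h
  have nwt : ‖wA t‖ ≤ K * (ε * b) := by
    rw [ht, hW.σ]; exact (hB.σ _).trans (mul_le_mul_of_nonneg_left nwh hK0)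
  have nrest := hB.norm_weight_NL_add_NQ_le hW nq ns nt nwh nwt
  have nQ := hB.norm_weight_weight_NQ_le hW nwh nwt
  have nN := hB.norm_N_le nq ns
  have hεb : 0 ≤ ε * b := mul_nonneg hε hb0
  -- 14 = 1 + 6 + 1 + 6 counts the monomials, all dominated by K⁶ since K ≥ 1. The hypothesis on ε
  -- has 56 = 4 · 14, so this is at most b/4.
  have rest14 : ‖wZ (S.NL q s h' t + S.NQ h' t)‖ ≤ 14 * K ^ 6 * ε * b := by
    refine nrest.trans ?_
    have e : ε * b * K + ε * b * K * (2 * K ^ 3) + 2 * K ^ 2 * K * (K * (ε * b))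
      + K * (K * (ε * b)) * K + K * (K * (ε * b)) * K * (2 * K ^ 3)
      + K * (2 * K ^ 3) * K * (K * (ε * b)) + (ε * b * K * (2 * K ^ 3)
        + K * (K * (ε * b)) * K * (2 * K ^ 3))
      = (ε * b) * (K ^ 1 + 6 * K ^ 4 + K ^ 3 + 6 * K ^ 6) := by ring
    rw [e]
    have := mul_le_mul_of_nonneg_left (show K ^ 1 + 6 * K ^ 4 + K ^ 3 + 6 * K ^ 6 ≤ 14 * K ^ 6 by
      linarith [pw (show 1 ≤ 6 by norm_num), pw (show 4 ≤ 6 by norm_num),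
        pw (show 3 ≤ 6 by norm_num)]) hεb
    linarith
  have rest4 : ‖wZ (S.NL q s h' t + S.NQ h' t)‖ ≤ b / 4 := by
    refine rest14.trans ?_
    have := mul_le_mul_of_nonneg_right hεK hb0
    linarith
  have nQ' : ‖wZ (wZ (S.NQ h' t))‖ ≤ 2 * K ^ 4 * (ε * b) ^ 2 := by
    refine nQ.trans ?_
    have e : ε * b * K * (K * (ε * b)) + K * (K * (ε * b)) * K * (K * (ε * b))
      = (K ^ 2 + K ^ 4) * (ε * b) ^ 2 := by ring
    rw [e]
    exact mul_le_mul_of_nonneg_right (by linarith [pw (show 2 ≤ 4 by norm_num)]) (sq_nonneg _)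
  have nop : ‖S.op d₀ q₀ s₀ p‖ ≤ 14 * K ^ 8 := by
    have n1 : ‖S.D p‖ ≤ K * K := (hB.D p).trans (mul_le_mul_of_nonneg_left hp hK0)
    have n2 : ‖S.ι (S.N q s)‖ ≤ _ := (hB.ι _).trans nN
    have n3 : ‖S.op d₀ q₀ s₀ p‖ ≤ ‖S.D p‖ + ‖d₀‖ + ‖S.ι (S.N q s)‖ := norm_add₃_le
    have e : 2 * K ^ 2 * K + 2 * K ^ 2 * K * (2 * K ^ 3) + K * (2 * K ^ 3) * K
        + K * (2 * K ^ 3) * K * (2 * K ^ 3) = 2 * K ^ 3 + 4 * K ^ 6 + 2 * K ^ 5 + 4 * K ^ 8 := by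
      ring
    rw [e] at n2
    linarith [pw (show 1 ≤ 8 by norm_num), pw (show 2 ≤ 8 by norm_num),
      pw (show 3 ≤ 8 by norm_num), pw (show 5 ≤ 8 by norm_num), pw (show 6 ≤ 8 by norm_num)]
  have hop := S.op_add d₀ q₀ s₀ p h
  rw [← hq, ← hs, ← hh', ← ht] at hop
  set Φ := S.op d₀ q₀ s₀ p with hΦ
  set Λ := S.D h + S.ι (S.NL q s h' t) with hΛ
  set Q := S.ι (S.NQ h' t) with hQ
  have hΛQ : b * (3 / 4) ≤ ‖wY (Λ + Q)‖ := by
    have e1 : Λ + Q = S.D h + S.ι (S.NL q s h' t + S.NQ h' t) := by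
      rw [hΛ, hQ, map_add]; abel
    rw [e1, map_add, hW.ι]
    have e2 := norm_sub_le_norm_add (wY (S.D h)) (S.ι (wZ (S.NL q s h' t + S.NQ h' t)))
    have e3 := hB.ι (wZ (S.NL q s h' t + S.NQ h' t))
    linarith
  -- The value Φ is only bounded, not small. Symmetry puts both weights on Q, which yields (ε b)²
  -- and beats the large bound on Φ.
  have hcross : |⟪wY Φ, wY Q⟫_ℝ| ≤ b ^ 2 / 56 := by
    rw [hW.symm, hQ, hW.ι, hW.ι]
    refine (abs_real_inner_le_norm _ _).trans ?_
    have e3 := (hB.ι (wZ (wZ (S.NQ h' t)))).trans nQ'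
    have e4 := mul_le_mul nop e3 (norm_nonneg _) (by positivity)
    have e5 : 14 * K ^ 8 * (2 * K ^ 4 * (ε * b) ^ 2) = (56 * K ^ 6 * ε) ^ 2 * b ^ 2 / 112 := by ring
    have e6 : (56 * K ^ 6 * ε) ^ 2 ≤ 1 := pow_le_one₀ (by positivity) hεK
    have e7 := mul_le_mul_of_nonneg_right e6 (sq_nonneg b)
    linarith [sq_nonneg b]
  have e8 : wY (S.op d₀ q₀ s₀ (p + h)) = wY Φ + wY (Λ + Q) := by
    rw [hop, ← map_add]; congr 1; abel
  have e9 : ⟪wY Φ, wY (Λ + Q)⟫_ℝ = ⟪wY Φ, wY Λ⟫_ℝ + ⟪wY Φ, wY Q⟫_ℝ := by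
    rw [map_add, inner_add_right]
  rw [e8, norm_add_sq_real, e9]
  -- The surplus is at least 9/16 − 2/56 > 1/2 times b².
  have e10 : (b * (3 / 4)) ^ 2 ≤ ‖wY (Λ + Q)‖ ^ 2 := pow_le_pow_left₀ (by positivity) hΛQ 2
  have e11 := neg_abs_le ⟪wY Φ, wY Q⟫_ℝ
  have e12 : (b * (3 / 4)) ^ 2 = 9 / 16 * b ^ 2 := by ring
  linarith [sq_nonneg b]

/-- The weighted quadratic functional has a unique minimizer on the ball of radius `R`. -/
theorem exists_unique_isMinOn [CompleteSpace X] (hB : S.Bounded K) (hW : S.Weight ε wY wZ wA)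
    (hε : 0 ≤ ε) (hεK : 56 * K ^ 6 * ε ≤ 1) {d₀ : Y} {q₀ : Z} {s₀ : A} (hd₀ : ‖d₀‖ ≤ K)
    (hq₀ : ‖q₀‖ ≤ K) (hs₀ : ‖s₀‖ ≤ K) {R : ℝ} (hR : 0 ≤ R) (hRK : R ≤ K) {E c : ℝ} (hE : 0 < E)
    (hc : 0 < c) (hD : ∀ h, c * ‖h‖ ≤ ‖wY (S.D h)‖) {J : X → ℝ}
    (hJ : ∀ p, J p = E * ‖wY (S.op d₀ q₀ s₀ p)‖ ^ 2) :
    ∃ pmin ∈ Metric.closedBall (0 : X) R, IsMinOn J (Metric.closedBall 0 R) pmin ∧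
      (∀ q ∈ Metric.closedBall (0 : X) R, IsMinOn J (Metric.closedBall 0 R) q → q = pmin) ∧
      ∃ g : X, HasFDerivAt J (innerSL ℝ g) pmin ∧
        ∀ y ∈ Metric.closedBall (0 : X) R, 0 ≤ ⟪g, y - pmin⟫_ℝ := by
  choose Φ' hΦ' hΦ'eq using S.exists_hasFDerivAt_op d₀ q₀ s₀
  have hJ' : ∀ p, HasFDerivAt J
      (E • (2 • (innerSL ℝ (wY (S.op d₀ q₀ s₀ p))).comp (wY.comp (Φ' p)))) p := by
    intro p
    have h1 := ((wY.hasFDerivAt.comp p (hΦ' p)).norm_sq).const_mul E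
    have h2 : J = fun p => E * ‖(wY ∘ S.op d₀ q₀ s₀) p‖ ^ 2 := funext hJ
    rw [h2]
    exact h1
  refine exists_unique_isMinOn_of_strongly_convex (convex_closedBall _ _)
    Metric.isClosed_closedBall ⟨0, by simpa using hR⟩ (c := E * (c ^ 2 / 2)) (by positivity)
    (fun p => by rw [hJ]; positivity) hJ' fun p hp q hq => ?_
  rw [mem_closedBall_zero_iff] at hp hq
  have h1 := weighted_convexity hB hW hε hεK hd₀ hq₀ hs₀ (hp.trans hRK) (h := q - p)
    ((norm_sub_le _ _).trans (by linarith))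
  rw [add_sub_cancel, ← hΦ'eq] at h1
  have h2 : c ^ 2 * ‖q - p‖ ^ 2 ≤ ‖wY (S.D (q - p))‖ ^ 2 := by
    rw [← mul_pow]; exact pow_le_pow_left₀ (by positivity) (hD _) 2
  rw [hJ, hJ]
  have h3 : (E • (2 • (innerSL ℝ (wY (S.op d₀ q₀ s₀ p))).comp (wY.comp (Φ' p)))) (q - p)
      = E * (2 * ⟪wY (S.op d₀ q₀ s₀ p), wY (Φ' p (q - p))⟫_ℝ) := by
    simp only [_root_.smul_apply, ContinuousLinearMap.comp_apply, innerSL_apply_apply, smul_eq_mul,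
      nsmul_eq_mul, Nat.cast_ofNat]
  rw [h3]
  have h4 := mul_le_mul_of_nonneg_left h1 hE.le
  have h5 := mul_le_mul_of_nonneg_left h2 hE.le
  linarith

end QuadOp

namespace CWF

/-! ### Sobolev functions on the unit interval -/

theorem norm_sq_eq_integral_norm_sq {α E : Type*} [MeasurableSpace α] {μ : Measure α}
    [NormedAddCommGroup E] [InnerProductSpace ℝ E] (f : Lp E 2 μ) :
    ‖f‖ ^ 2 = ∫ a, ‖f a‖ ^ 2 ∂μ := by
  rw [← real_inner_self_eq_norm_sq, L2.inner_def]
  simp only [real_inner_self_eq_norm_sq]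

/-- Continuous functions on `[0,1]`. -/
abbrev CI : Type := C(Icc (0 : ℝ) 1, ℂ)

/-- The measure on `(0,1)`. -/
abbrev μI : Measure ℝ := volume.restrict (Ioo (0 : ℝ) 1)

instance : IsProbabilityMeasure μI := ⟨by simp⟩

/-- The constant extension of a continuous function on `[0,1]` to the real line. -/
def CI.ext (F : CI) : ℝ → ℂ := IccExtend zero_le_one F

theorem CI.continuous_ext (F : CI) : Continuous F.ext := F.continuous.Icc_extend'

theorem CI.ext_apply (F : CI) {x : ℝ} (hx : x ∈ Icc (0 : ℝ) 1) : F.ext x = F ⟨x, hx⟩ :=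
  IccExtend_of_mem _ _ hx

theorem CI.norm_ext_le (F : CI) (x : ℝ) : ‖F.ext x‖ ≤ ‖F‖ := F.norm_coe_le_norm _

theorem CI.memLp_ext (F : CI) : MemLp F.ext 2 μI :=
  MemLp.of_bound F.continuous_ext.aestronglyMeasurable ‖F‖ (ae_of_all _ F.norm_ext_le)

/-- The inclusion of the continuous functions into `L²(0,1)`. -/
def inclL2 : CI →L[ℝ] L2I :=
  LinearMap.mkContinuous
    { toFun := fun F => F.memLp_ext.toLp
      map_add' := fun F G => by rw [← MemLp.toLp_add]; rfl
      map_smul' := fun a F => by rw [RingHom.id_apply, ← MemLp.toLp_const_smul]; rfl } 1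
    fun F => by
      refine (Lp.norm_le_of_ae_bound (C := ‖F‖) (norm_nonneg F) ?_).trans ?_
      · filter_upwards [F.memLp_ext.coeFn_toLp] with x hx
        exact (congrArg norm hx).trans_le (F.norm_ext_le x)
      · simp [measureUnivNNReal]

theorem coeFn_inclL2 (F : CI) : inclL2 F =ᵐ[μI] F.ext := F.memLp_ext.coeFn_toLp

theorem norm_inclL2_le (F : CI) : ‖inclL2 F‖ ≤ ‖F‖ :=
  (LinearMap.mkContinuous_norm_le _ zero_le_one _ |> inclL2.le_of_opNorm_le <| F).trans_eq
    (one_mul _)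

/-! ### Primitives of square-integrable functions -/

theorem L2I_integrable (f : L2I) : Integrable f μI := (Lp.memLp f).integrable (by norm_num)

theorem L2I_intervalIntegrable (f : L2I) {a b : ℝ} (ha : a ∈ Icc (0 : ℝ) 1)
    (hb : b ∈ Icc (0 : ℝ) 1) : IntervalIntegrable f volume a b := by
  have h : IntervalIntegrable f volume 0 1 :=
    (intervalIntegrable_iff_integrableOn_Ioo_of_le zero_le_one).2 (L2I_integrable f)
  refine h.mono_set ?_
  rw [uIcc_of_le zero_le_one]
  exact uIcc_subset_Icc ha hb

/-- Cauchy–Schwarz for a weighted primitive. -/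
theorem integral_mul_norm_le (f : L2I) {a : ℝ → ℝ} (ha : Continuous a) (ha0 : ∀ x, 0 ≤ a x) {x : ℝ}
    (hx : x ∈ Icc (0 : ℝ) 1) :
    ∫ y in Ioo 0 x, a y * ‖f y‖ ≤ √(∫ y in Ioo 0 x, a y ^ 2) * ‖f‖ := by
  have hsub : Ioo 0 x ⊆ Ioo (0 : ℝ) 1 := Ioo_subset_Ioo_right hx.2
  have hle : volume.restrict (Ioo 0 x) ≤ μI := Measure.restrict_mono hsub le_rfl
  have e2 : ENNReal.ofReal 2 = 2 := by simp
  have hf : MemLp (fun y => ‖f y‖) (ENNReal.ofReal 2) (volume.restrict (Ioo 0 x)) := by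
    rw [e2]; exact ((Lp.memLp f).mono_measure hle).norm
  have hA : MemLp a (ENNReal.ofReal 2) (volume.restrict (Ioo 0 x)) := by
    rw [e2]
    obtain ⟨C, hC⟩ := isCompact_Icc.exists_bound_of_continuousOn (ha.continuousOn (s := Icc 0 x))
    refine MemLp.of_bound ha.aestronglyMeasurable C ?_
    filter_upwards [ae_restrict_mem measurableSet_Ioo] with y hy
    exact hC y (Ioo_subset_Icc_self hy)
  have h := integral_mul_le_Lp_mul_Lq_of_nonneg (Real.HolderConjugate.two_two)
    (ae_of_all _ ha0) (ae_of_all _ fun y => norm_nonneg (f y)) hA hf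
  refine h.trans ?_
  have e3 : ∀ t : ℝ, t ^ (1 / 2 : ℝ) = √t := fun t => (Real.sqrt_eq_rpow t).symm
  simp only [e3, Real.rpow_two]
  refine mul_le_mul_of_nonneg_left ?_ (Real.sqrt_nonneg _)
  refine Real.sqrt_le_iff.2 ⟨norm_nonneg _, ?_⟩
  rw [norm_sq_eq_integral_norm_sq]
  exact integral_mono_measure hle (ae_of_all _ fun _ => by positivity)
    ((Lp.memLp f).integrable_norm_pow two_ne_zero)

theorem norm_intervalIntegral_le_norm (f : L2I) {x : ℝ} (hx : x ∈ Icc (0 : ℝ) 1) :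
    ‖∫ y in (0 : ℝ)..x, f y‖ ≤ ‖f‖ := by
  rw [intervalIntegral.integral_of_le hx.1, integral_Ioc_eq_integral_Ioo]
  refine (norm_integral_le_integral_norm _).trans ?_
  have h := integral_mul_norm_le f continuous_const (fun _ => zero_le_one) hx
  simp only [one_mul, one_pow] at h
  refine h.trans ?_
  have : √(∫ _ in Ioo 0 x, (1 : ℝ)) ≤ 1 := by
    refine Real.sqrt_le_iff.2 ⟨zero_le_one, ?_⟩
    simpa [hx.1] using hx.2
  simpa using mul_le_mul_of_nonneg_right this (norm_nonneg f)

/-- The primitive of an `L²` function that vanishes at `0`, as a continuous function. -/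
def primFun (f : L2I) : CI where
  toFun x := ∫ y in (0 : ℝ)..x, f y
  continuous_toFun := by
    have := intervalIntegral.continuousOn_primitive_interval' (μ := volume)
      (L2I_intervalIntegrable f (left_mem_Icc.2 zero_le_one) (right_mem_Icc.2 zero_le_one))
      left_mem_uIcc
    rw [uIcc_of_le zero_le_one] at this
    exact continuousOn_iff_continuous_domRestrict.1 this

theorem primFun_apply (f : L2I) (x : Icc (0 : ℝ) 1) : primFun f x = ∫ y in (0 : ℝ)..x, f y := rfl

/-- The primitive vanishing at `0`. -/
def prim : L2I →L[ℝ] CI :=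
  LinearMap.mkContinuous
    { toFun := primFun
      map_add' := fun f g => by
        ext x
        have h0 : (0 : ℝ) ∈ Icc (0 : ℝ) 1 := left_mem_Icc.2 zero_le_one
        simp only [primFun_apply, ContinuousMap.add_apply]
        rw [← intervalIntegral.integral_add (L2I_intervalIntegrable f h0 x.2)
          (L2I_intervalIntegrable g h0 x.2), intervalIntegral.integral_of_le x.2.1,
          intervalIntegral.integral_of_le x.2.1, integral_Ioc_eq_integral_Ioo,
          integral_Ioc_eq_integral_Ioo]
        exact integral_congr_ae
          (ae_mono (Measure.restrict_mono (Ioo_subset_Ioo_right x.2.2) le_rfl) (Lp.coeFn_add f g))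
      map_smul' := fun a f => by
        ext x
        simp only [primFun_apply, ContinuousMap.smul_apply, RingHom.id_apply]
        rw [← intervalIntegral.integral_smul, intervalIntegral.integral_of_le x.2.1,
          intervalIntegral.integral_of_le x.2.1, integral_Ioc_eq_integral_Ioo,
          integral_Ioc_eq_integral_Ioo]
        exact integral_congr_ae
          (ae_mono (Measure.restrict_mono (Ioo_subset_Ioo_right x.2.2) le_rfl)
            (Lp.coeFn_smul a f)) } 1
    fun f => by
      rw [one_mul]
      exact (ContinuousMap.norm_le _ (norm_nonneg _)).2 fun x =>
        norm_intervalIntegral_le_norm f x.2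

theorem prim_apply (f : L2I) (x : Icc (0 : ℝ) 1) : prim f x = ∫ y in (0 : ℝ)..x, f y := rfl

theorem norm_prim_le (f : L2I) : ‖prim f‖ ≤ ‖f‖ :=
  (ContinuousMap.norm_le _ (norm_nonneg _)).2 fun x => norm_intervalIntegral_le_norm f x.2

theorem prim_zero (f : L2I) (h : (0 : ℝ) ∈ Icc (0 : ℝ) 1) : prim f ⟨0, h⟩ = 0 := by
  simp [prim_apply]

/-! #### Weak derivatives -/

theorem eq_zero_of_notMem_Ioo_of_tsupport {φ : ℝ → ℝ} (h : tsupport φ ⊆ Ioo 0 1) {x : ℝ}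
    (hx : x ∉ Ioo (0 : ℝ) 1) : φ x = 0 :=
  image_eq_zero_of_notMem_tsupport fun h' => hx (h h')

theorem isWeakDeriv_const (c : ℂ) : IsWeakDeriv (inclL2 (ContinuousMap.const _ c)) 0 := by
  intro φ hφ hc hs
  have hd : Continuous (deriv φ) := hφ.continuous_deriv (by simp)
  have e0 : ∫ x in Ioo (0 : ℝ) 1, φ x • (0 : L2I) x = 0 := by
    rw [integral_congr_ae (g := fun _ => (0 : ℂ)), integral_zero]
    filter_upwards [Lp.coeFn_zero ℂ 2 μI] with x hx
    simp only [hx, Pi.zero_apply, smul_zero]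
  have e1 : ∫ x in Ioo (0 : ℝ) 1, deriv φ x • inclL2 (ContinuousMap.const _ c) x
      = ∫ x in Ioo (0 : ℝ) 1, deriv φ x • c := by
    refine integral_congr_ae ?_
    filter_upwards [coeFn_inclL2 (ContinuousMap.const _ c)] with x hx
    rw [hx]; rfl
  rw [e0, e1, integral_smul_const, ← integral_Ioc_eq_integral_Ioo,
    ← intervalIntegral.integral_of_le zero_le_one, intervalIntegral.integral_deriv_eq_sub
      (fun x _ => (hφ.differentiable (by simp)).differentiableAt) (hd.intervalIntegrable _ _),
    eq_zero_of_notMem_Ioo_of_tsupport hs (by simp), eq_zero_of_notMem_Ioo_of_tsupport hs (by simp)]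
  simp

/-- Fubini on the triangle y < x: the integral of φ' over (y,1) is −φ(y), because φ vanishes at 1.
-/
theorem isWeakDeriv_prim (g : L2I) : IsWeakDeriv (inclL2 (prim g)) g := by
  intro φ hφ hc hs
  have hd : Continuous (deriv φ) := hφ.continuous_deriv (by simp)
  have hdi : Integrable (deriv φ) μI := (hd.integrable_of_hasCompactSupport hc.deriv).integrableOn
  have hint : Integrable (Function.uncurry fun x y : ℝ =>
      {p : ℝ × ℝ | p.2 < p.1}.indicator (fun p => deriv φ p.1 • g p.2) (x, y)) (μI.prod μI) :=
    (hdi.smul_prod (L2I_integrable g)).indicator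
      (measurableSet_lt measurable_snd measurable_fst)
  have e1 : ∀ x ∈ Ioo (0 : ℝ) 1, deriv φ x • (prim g).ext x = ∫ y in Ioo (0 : ℝ) 1,
      {p : ℝ × ℝ | p.2 < p.1}.indicator (fun p => deriv φ p.1 • g p.2) (x, y) := by
    intro x hx
    have : ∀ y, {p : ℝ × ℝ | p.2 < p.1}.indicator (fun p => deriv φ p.1 • g p.2) (x, y)
        = (Iio x).indicator (fun y => deriv φ x • g y) y := fun y => rfl
    simp only [this]
    rw [integral_indicator measurableSet_Iio, Measure.restrict_restrict measurableSet_Iio,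
      CI.ext_apply _ (Ioo_subset_Icc_self hx), prim_apply, integral_smul]
    have : Iio x ∩ Ioo 0 1 = Ioo 0 x := by
      ext y; simp only [mem_inter_iff, mem_Iio, mem_Ioo]
      exact ⟨fun h => ⟨h.2.1, h.1⟩, fun h => ⟨h.2, h.1, h.2.trans hx.2⟩⟩
    rw [this, intervalIntegral.integral_of_le hx.1.le, integral_Ioc_eq_integral_Ioo]
  have e2 : ∀ y ∈ Ioo (0 : ℝ) 1, ∫ x in Ioo (0 : ℝ) 1,
      {p : ℝ × ℝ | p.2 < p.1}.indicator (fun p => deriv φ p.1 • g p.2) (x, y) = -(φ y • g y) := by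
    intro y hy
    have : ∀ x, {p : ℝ × ℝ | p.2 < p.1}.indicator (fun p => deriv φ p.1 • g p.2) (x, y)
        = (Ioi y).indicator (fun x => deriv φ x • g y) x := fun x => rfl
    simp only [this]
    rw [integral_indicator measurableSet_Ioi, Measure.restrict_restrict measurableSet_Ioi]
    have : Ioi y ∩ Ioo 0 1 = Ioo y 1 := by
      ext x; simp only [mem_inter_iff, mem_Ioi, mem_Ioo]
      exact ⟨fun h => ⟨h.1, h.2.2⟩, fun h => ⟨h.1, hy.1.trans h.1, h.2⟩⟩
    rw [this, integral_smul_const, ← integral_Ioc_eq_integral_Ioo,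
      ← intervalIntegral.integral_of_le hy.2.le, intervalIntegral.integral_deriv_eq_sub
      (fun x _ => (hφ.differentiable (by simp)).differentiableAt) (hd.intervalIntegrable _ _),
      eq_zero_of_notMem_Ioo_of_tsupport hs (x := 1) (by simp), zero_sub, neg_smul]
  calc ∫ x in Ioo (0 : ℝ) 1, deriv φ x • inclL2 (prim g) x
      = ∫ x in Ioo (0 : ℝ) 1, deriv φ x • (prim g).ext x := by
        refine integral_congr_ae ?_
        filter_upwards [coeFn_inclL2 (prim g)] with x hx
        rw [hx]
    _ = _ := setIntegral_congr_fun measurableSet_Ioo e1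
    _ = _ := integral_integral_swap hint
    _ = ∫ y in Ioo (0 : ℝ) 1, -(φ y • g y) := setIntegral_congr_fun measurableSet_Ioo e2
    _ = _ := integral_neg _

/-- A compactly supported smooth function on `(0,1)` with integral zero has a compactly supported
smooth primitive. -/
theorem exists_primitive_of_integral_eq_zero {χ : ℝ → ℝ} (hχ : ContDiff ℝ ∞ χ)
    (hc : HasCompactSupport χ) (hs : tsupport χ ⊆ Ioo 0 1) (h0 : ∫ x, χ x = 0) :
    ∃ φ : ℝ → ℝ, ContDiff ℝ ∞ φ ∧ HasCompactSupport φ ∧ tsupport φ ⊆ Ioo 0 1 ∧ deriv φ = χ := by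
  -- The primitive from 0 vanishes left of a because χ does, and right of b because the total
  -- integral of χ is zero.
  obtain ⟨a, b, ha, hb, hab⟩ : ∃ a b : ℝ, 0 < a ∧ b < 1 ∧ tsupport χ ⊆ Icc a b := by
    rcases (tsupport χ).eq_empty_or_nonempty with he | hne
    · exact ⟨1 / 2, 1 / 2, by norm_num, by norm_num, by simp [he]⟩
    · have hcc : IsCompact (tsupport χ) := hc
      exact ⟨sInf (tsupport χ), sSup (tsupport χ), (hs (hcc.sInf_mem hne)).1,
        (hs (hcc.sSup_mem hne)).2, fun x hx => ⟨csInf_le hcc.bddBelow hx, le_csSup hcc.bddAbove hx⟩⟩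
  have hz : ∀ x, x ∉ Icc a b → χ x = 0 := fun x hx =>
    image_eq_zero_of_notMem_tsupport fun h => hx (hab h)
  have hder : ∀ x, HasDerivAt (fun x => ∫ y in (0 : ℝ)..x, χ y) (χ x) x := fun x =>
    hχ.continuous.integral_hasStrictDerivAt 0 x |>.hasDerivAt
  have hderiv : deriv (fun x => ∫ y in (0 : ℝ)..x, χ y) = χ := funext fun x => (hder x).deriv
  have hsupp : tsupport (fun x => ∫ y in (0 : ℝ)..x, χ y) ⊆ Icc a b := by
    refine closure_minimal (fun x hx => ?_) isClosed_Icc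
    by_contra hcon
    refine hx ?_
    rcases lt_or_ge x a with hxa | hxa
    · have : ∫ y in (0 : ℝ)..x, χ y = ∫ y in (0 : ℝ)..x, 0 := by
        refine intervalIntegral.integral_congr fun y hy => hz y fun hy' => ?_
        have h1 := hy.2
        exact absurd (hy'.1.trans h1) (not_le.2 (max_lt ha hxa))
      simpa using this
    · have hxb : b < x := by
        by_contra! h
        exact hcon ⟨hxa, h⟩
      change ∫ y in (0 : ℝ)..x, χ y = 0
      rw [intervalIntegral.integral_eq_integral_of_support_subset, h0]
      intro y hy
      have hy' : y ∈ Icc a b := by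
        by_contra h
        exact hy (hz y h)
      exact ⟨ha.trans_le hy'.1, hy'.2.trans hxb.le⟩
  refine ⟨fun x => ∫ y in (0 : ℝ)..x, χ y, ?_, ?_, ?_, hderiv⟩
  · exact contDiff_infty_iff_deriv.2 ⟨fun x => (hder x).differentiableAt, hderiv.symm ▸ hχ⟩
  · exact isCompact_Icc.of_isClosed_subset (isClosed_tsupport _) hsupp
  · exact hsupp.trans fun x hx => ⟨ha.trans_le hx.1, hx.2.trans_lt hb⟩

/-- du Bois-Reymond's lemma. -/
theorem exists_eq_const_of_isWeakDeriv_zero {f : L2I} (hf : IsWeakDeriv f 0) :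
    ∃ c : ℂ, f = inclL2 (ContinuousMap.const _ c) := by
  have hf' : ∀ φ : ℝ → ℝ, ContDiff ℝ ∞ φ → HasCompactSupport φ → tsupport φ ⊆ Ioo 0 1 →
      ∫ x in Ioo (0 : ℝ) 1, deriv φ x • f x = 0 := by
    intro φ h1 h2 h3
    rw [hf φ h1 h2 h3, integral_congr_ae (g := fun _ => (0 : ℂ)), integral_zero, neg_zero]
    filter_upwards [Lp.coeFn_zero ℂ 2 μI] with x hx
    simp only [hx, Pi.zero_apply, smul_zero]
  -- With θ of integral one, any test function ψ minus (∫ψ)θ has integral zero, so it is the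
  -- derivative of a test function and is annihilated by f. Thus f acts on ψ as the constant ∫ θ f.
  let θ₀ : ContDiffBump (1 / 2 : ℝ) := ⟨1 / 8, 1 / 4, by norm_num, by norm_num⟩
  set θ : ℝ → ℝ := θ₀.normed volume with hθ
  have θd : ContDiff ℝ ∞ θ := θ₀.contDiff_normed
  have θc : HasCompactSupport θ := θ₀.hasCompactSupport_normed
  have θs : tsupport θ ⊆ Ioo 0 1 := by
    rw [hθ, θ₀.tsupport_normed_eq]
    intro x hx
    have : |x - 1 / 2| ≤ 1 / 4 := by
      have := Metric.mem_closedBall.1 hx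
      rwa [Real.dist_eq] at this
    rw [abs_le] at this
    constructor <;> linarith [this.1, this.2]
  have θi : ∫ x, θ x = 1 := θ₀.integral_normed
  set c := ∫ x in Ioo (0 : ℝ) 1, θ x • f x with hc
  refine ⟨c, ?_⟩
  have key : ∀ᵐ x ∂μI, x ∈ Ioo (0 : ℝ) 1 → f x - c = 0 := by
    refine isOpen_Ioo.ae_eq_zero_of_integral_contDiff_smul_eq_zero
      (((L2I_integrable f).sub (integrable_const c)).locallyIntegrable.locallyIntegrableOn _)
      fun ψ ψd ψc ψs => ?_
    set A := ∫ x, ψ x with hA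
    obtain ⟨φ, φd, φc, φs, hφ⟩ := exists_primitive_of_integral_eq_zero
      (χ := fun x => ψ x - A * θ x) (ψd.sub (contDiff_const.mul θd)) (ψc.sub θc.mul_left)
      ((tsupport_sub ψ fun x => A * θ x).trans (union_subset ψs
        ((tsupport_mul_subset_right (f := fun _ => A) (g := θ)).trans θs)))
      (by
        rw [integral_sub (ψd.continuous.integrable_of_hasCompactSupport ψc)
          ((θd.continuous.integrable_of_hasCompactSupport θc).const_mul A),
          integral_const_mul, θi, mul_one, sub_self])
    have h1 := hf' φ φd φc φs
    rw [hφ] at h1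
    have iψ := integrable_smul_L2I ψd.continuous ψc f
    have iθ := integrable_smul_L2I θd.continuous θc f
    have hA' : ∫ x in Ioo (0 : ℝ) 1, ψ x = A :=
      setIntegral_eq_integral_of_forall_compl_eq_zero fun x hx =>
        eq_zero_of_notMem_Ioo_of_tsupport ψs hx
    have e1 : ∫ x in Ioo (0 : ℝ) 1, (ψ x - A * θ x) • f x
        = (∫ x in Ioo (0 : ℝ) 1, ψ x • f x) - A • c := by
      rw [hc, ← integral_smul, ← integral_sub iψ (iθ.fun_smul A)]
      refine integral_congr_ae (ae_of_all _ fun x => ?_)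
      simp only [sub_smul, mul_smul]
    have e2 : ∫ x in Ioo (0 : ℝ) 1, ψ x • (f x - c)
        = (∫ x in Ioo (0 : ℝ) 1, ψ x • f x) - A • c := by
      rw [← hA', ← integral_smul_const, ← integral_sub iψ
        ((ψd.continuous.integrable_of_hasCompactSupport ψc).integrableOn.smul_const c)]
      simp only [smul_sub]
    change ∫ x in Ioo (0 : ℝ) 1, ψ x • (f x - c) = 0
    rw [e2, ← e1, h1]
  refine Lp.ext ?_
  filter_upwards [key, coeFn_inclL2 (ContinuousMap.const _ c), ae_restrict_mem measurableSet_Ioo]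
    with x h1 h2 h3
  rw [h2, sub_eq_zero.1 (h1 h3)]
  rfl

/-- The difference f − `prim g` has weak derivative zero. This makes the function spaces concrete:
every weakly differentiable function is a constant plus a primitive. -/
theorem IsWeakDeriv.exists_eq {f g : L2I} (h : IsWeakDeriv f g) :
    ∃ c : ℂ, f = inclL2 (ContinuousMap.const _ c + prim g) := by
  have h1 : IsWeakDeriv (f + (-1 : ℝ) • inclL2 (prim g)) 0 := by
    have := h.add ((isWeakDeriv_prim g).smul (-1))
    rwa [neg_one_smul ℝ g, add_neg_cancel] at this
  obtain ⟨c, hc⟩ := exists_eq_const_of_isWeakDeriv_zero h1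
  refine ⟨c, ?_⟩
  rw [map_add, ← hc]
  module

theorem isWeakDeriv_const_add_prim (c : ℂ) (g : L2I) :
    IsWeakDeriv (inclL2 (ContinuousMap.const _ c + prim g)) g := by
  simpa using (isWeakDeriv_const c).add (isWeakDeriv_prim g)

/-! #### Continuous representatives -/

theorem eqOn_Icc_of_ae_eq_Ioo {F G : ℝ → ℂ} (hF : ContinuousOn F (Icc 0 1))
    (hG : ContinuousOn G (Icc 0 1)) (h : F =ᵐ[μI] G) : EqOn F G (Icc 0 1) :=
  Measure.eqOn_Icc_of_ae_eq volume zero_ne_one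
    (by rwa [← restrict_Ioo_eq_restrict_Icc]) hF hG

/-- The choice inside `contRep` is harmless on [0,1]: continuous representatives that agree almost
everywhere on (0,1) agree on the closed interval. -/
theorem contRep_inclL2 (F : CI) {x : ℝ} (hx : x ∈ Icc (0 : ℝ) 1) :
    contRep (inclL2 F) x = F ⟨x, hx⟩ := by
  have hex : ∃ G : ℝ → ℂ, ContinuousOn G (Icc 0 1) ∧ inclL2 F =ᵐ[μI] G :=
    ⟨F.ext, F.continuous_ext.continuousOn, coeFn_inclL2 F⟩
  rw [contRep, dif_pos hex, ← F.ext_apply hx]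
  exact eqOn_Icc_of_ae_eq_Ioo hex.choose_spec.1 F.continuous_ext.continuousOn
    (hex.choose_spec.2.symm.trans (coeFn_inclL2 F)) hx

theorem hasValueAt_inclL2_iff (F : CI) {x : ℝ} (hx : x ∈ Icc (0 : ℝ) 1) {v : ℂ} :
    HasValueAt (inclL2 F) x v ↔ F ⟨x, hx⟩ = v := by
  constructor
  · rintro ⟨G, hG, hFG, rfl⟩
    rw [← F.ext_apply hx]
    exact eqOn_Icc_of_ae_eq_Ioo F.continuous_ext.continuousOn hG ((coeFn_inclL2 F).symm.trans hFG) hx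
  · rintro rfl
    exact ⟨F.ext, F.continuous_ext.continuousOn, coeFn_inclL2 F, F.ext_apply hx⟩

theorem zero_mem_unitInterval : (0 : ℝ) ∈ Icc (0 : ℝ) 1 := left_mem_Icc.2 zero_le_one

theorem one_mem_unitInterval : (1 : ℝ) ∈ Icc (0 : ℝ) 1 := right_mem_Icc.2 zero_le_one

theorem eq_const_add_prim {f g : L2I} (h : IsWeakDeriv f g) {v : ℂ} (hv : HasValueAt f 0 v) :
    f = inclL2 (ContinuousMap.const _ v + prim g) := by
  obtain ⟨c, rfl⟩ := h.exists_eq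
  rw [hasValueAt_inclL2_iff _ zero_mem_unitInterval] at hv
  simp only [ContinuousMap.add_apply, ContinuousMap.const_apply, prim_zero, add_zero] at hv
  rw [hv]

theorem eq_prim {f g : L2I} (h : IsWeakDeriv f g) (hv : HasValueAt f 0 0) :
    f = inclL2 (prim g) := by
  have : (ContinuousMap.const (Icc (0 : ℝ) 1) (0 : ℂ)) + prim g = prim g := by ext; simp
  rw [eq_const_add_prim h hv, this]

/-! #### The space `H2Space` -/

namespace H2Space

theorem D_one_eq (f : H2Space) : f.D 1 = inclL2 (prim (f.D 2)) :=
  eq_prim (f.1.2 1) f.2.2.1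

theorem D_zero_eq (f : H2Space) : f.D 0 = inclL2 (prim (f.D 1)) :=
  eq_prim (f.1.2 0) f.2.1

theorem prim_D_two_one (f : H2Space) : prim (f.D 2) ⟨1, one_mem_unitInterval⟩ = 0 := by
  rw [← hasValueAt_inclL2_iff _ one_mem_unitInterval, ← D_one_eq]
  exact f.2.2.2

/-- The underlying tuple `(f, f', f'')`. -/
def tuple (f : H2Space) : PiLp 2 fun _ : Fin 3 => L2I := f.1.1

theorem isometry_tuple : Isometry tuple := Isometry.of_dist_eq fun _ _ => rfl

theorem norm_sq_eq (f : H2Space) : ‖f‖ ^ 2 = ‖f.D 0‖ ^ 2 + ‖f.D 1‖ ^ 2 + ‖f.D 2‖ ^ 2 := by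
  have h : ‖f‖ ^ 2 = ‖f.tuple‖ ^ 2 := rfl
  rw [h, PiLp.norm_sq_eq_of_L2, Fin.sum_univ_three]
  rfl

theorem norm_D_le (f : H2Space) (j : Fin 3) : ‖f.D j‖ ≤ ‖f‖ := PiLp.norm_apply_le f.tuple j

/-- Poincaré's inequality twice, as f and f' vanish at 0; the factor 2 covers √3. -/
theorem norm_le (f : H2Space) : ‖f‖ ≤ 2 * ‖f.D 2‖ := by
  have h1 : ‖f.D 1‖ ≤ ‖f.D 2‖ := by
    rw [D_one_eq]; exact (norm_inclL2_le _).trans (norm_prim_le _)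
  have h0 : ‖f.D 0‖ ≤ ‖f.D 1‖ := by
    rw [D_zero_eq]; exact (norm_inclL2_le _).trans (norm_prim_le _)
  have h := f.norm_sq_eq
  refine le_of_sq_le_sq ?_ (by positivity)
  have e1 := pow_le_pow_left₀ (norm_nonneg _) h1 2
  have e0 := pow_le_pow_left₀ (norm_nonneg _) (h0.trans h1) 2
  rw [h, mul_pow]
  linarith [sq_nonneg ‖f.D 2‖]

/-- Weak derivatives and boundary values become equations between continuous operators, from which
closedness, and hence completeness of `H2Space`, is immediate. -/
theorem range_tuple : range tuple = {U | U 1 = inclL2 (prim (U 2)) ∧ U 0 = inclL2 (prim (U 1)) ∧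
    prim (U 2) ⟨1, one_mem_unitInterval⟩ = 0} := by
  ext U
  constructor
  · rintro ⟨f, rfl⟩
    exact ⟨f.D_one_eq, f.D_zero_eq, f.prim_D_two_one⟩
  · rintro ⟨h1, h0, h⟩
    have hS : U ∈ Sobolev 2 := by
      intro j
      fin_cases j
      · change IsWeakDeriv (U 0) (U 1)
        rw [h0]; exact isWeakDeriv_prim _
      · change IsWeakDeriv (U 1) (U 2)
        rw [h1]; exact isWeakDeriv_prim _
    refine ⟨⟨⟨U, hS⟩, ?_, ?_, ?_⟩, rfl⟩
    · change HasValueAt (U 0) 0 0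
      rw [h0, hasValueAt_inclL2_iff _ zero_mem_unitInterval, prim_zero]
    · change HasValueAt (U 1) 0 0
      rw [h1, hasValueAt_inclL2_iff _ zero_mem_unitInterval, prim_zero]
    · change HasValueAt (U 1) 1 0
      rw [h1, hasValueAt_inclL2_iff _ one_mem_unitInterval, h]

theorem isClosed_range_tuple : IsClosed (range tuple) := by
  rw [range_tuple]
  have c : ∀ j : Fin 3, Continuous fun U : PiLp 2 fun _ : Fin 3 => L2I => U j := fun j =>
    PiLp.continuous_apply 2 _ j
  have cp : ∀ j : Fin 3, Continuous fun U : PiLp 2 fun _ : Fin 3 => L2I => prim (U j) := fun j =>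
    prim.continuous.comp (c j)
  exact (isClosed_eq (c 1) (inclL2.continuous.comp (cp 2))).inter
    ((isClosed_eq (c 0) (inclL2.continuous.comp (cp 1))).inter
      (isClosed_eq ((continuous_eval_const _).comp (cp 2)) continuous_const))

instance : CompleteSpace H2Space :=
  isometry_tuple.isUniformInducing.completeSpace isClosed_range_tuple.isComplete

/-- The second derivative as a continuous linear map. -/
def DL : H2Space →L[ℝ] L2I :=
  LinearMap.mkContinuous
    { toFun := fun f => f.D 2
      map_add' := fun _ _ => rfl
      map_smul' := fun _ _ => rfl } 1 fun f => by
    rw [one_mul]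
    exact f.norm_D_le 2

theorem DL_apply (f : H2Space) : DL f = f.D 2 := rfl

theorem contRep_D_one (f : H2Space) {x : ℝ} (hx : x ∈ Icc (0 : ℝ) 1) :
    contRep (f.D 1) x = prim (DL f) ⟨x, hx⟩ := by
  rw [D_one_eq, contRep_inclL2 _ hx, DL_apply]

end H2Space

/-! #### The Carleman weight -/

/-- The square root `e^{-λx}` of the Carleman weight. -/
def wt (lam x : ℝ) : ℝ := Real.exp (-(lam * x))

theorem continuous_wt (lam : ℝ) : Continuous (wt lam) := by unfold wt; fun_prop

theorem wt_nonneg (lam x : ℝ) : 0 ≤ wt lam x := (Real.exp_pos _).le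

theorem exp_le_wt {lam : ℝ} (h : 0 ≤ lam) {x : ℝ} (hx : x ≤ 1) : Real.exp (-lam) ≤ wt lam x :=
  Real.exp_le_exp.2 (by nlinarith)

theorem memLp_wt_smul (lam : ℝ) (f : L2I) : MemLp (fun x => wt lam x • f x) 2 μI := by
  obtain ⟨C, hC⟩ :=
    isCompact_Icc.exists_bound_of_continuousOn ((continuous_wt lam).continuousOn (s := Icc 0 1))
  refine (Lp.memLp f).of_le_mul (c := C)
    ((continuous_wt lam).aestronglyMeasurable.smul (Lp.aestronglyMeasurable f)) ?_
  filter_upwards [ae_restrict_mem measurableSet_Ioo] with x hx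
  rw [norm_smul]
  exact mul_le_mul_of_nonneg_right (hC x (Ioo_subset_Icc_self hx)) (norm_nonneg _)

/-- Multiplication by `e^{-λx}` on `L²(0,1)`. -/
def weightL (lam : ℝ) : L2I →L[ℝ] L2I :=
  LinearMap.mkContinuousOfExistsBound
    { toFun := fun f => (memLp_wt_smul lam f).toLp
      map_add' := fun f g => by
        rw [← MemLp.toLp_add]
        refine MemLp.toLp_congr _ _ ?_
        filter_upwards [Lp.coeFn_add f g] with x hx
        simp only [hx, Pi.add_apply, smul_add]
      map_smul' := fun a f => by
        rw [RingHom.id_apply, ← MemLp.toLp_const_smul]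
        refine MemLp.toLp_congr _ _ ?_
        filter_upwards [Lp.coeFn_smul a f] with x hx
        simp only [hx, Pi.smul_apply, smul_comm a] } <| by
    obtain ⟨C, hC⟩ :=
      isCompact_Icc.exists_bound_of_continuousOn ((continuous_wt lam).continuousOn (s := Icc 0 1))
    refine ⟨C, fun f => Lp.norm_le_mul_norm_of_ae_le_mul ?_⟩
    filter_upwards [ae_restrict_mem measurableSet_Ioo, (memLp_wt_smul lam f).coeFn_toLp]
      with x hx hx'
    refine (congrArg norm hx').trans_le ?_
    rw [norm_smul]
    exact mul_le_mul_of_nonneg_right (hC x (Ioo_subset_Icc_self hx)) (norm_nonneg _)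

theorem coeFn_weightL (lam : ℝ) (f : L2I) : weightL lam f =ᵐ[μI] fun x => wt lam x • f x :=
  (memLp_wt_smul lam f).coeFn_toLp

/-- The weight is at least e^{-λ} on (0,1). The loss is harmless: the modulus of convexity may
depend on λ. -/
theorem norm_le_norm_weightL {lam : ℝ} (h : 0 ≤ lam) (f : L2I) :
    Real.exp (-lam) * ‖f‖ ≤ ‖weightL lam f‖ := by
  have h1 : ‖f‖ ≤ Real.exp lam * ‖weightL lam f‖ := by
    refine Lp.norm_le_mul_norm_of_ae_le_mul ?_
    filter_upwards [ae_restrict_mem measurableSet_Ioo, coeFn_weightL lam f] with x hx hx'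
    rw [hx', norm_smul, Real.norm_of_nonneg (wt_nonneg _ _), ← mul_assoc]
    have h2 := exp_le_wt h hx.2.le
    have h3 : 1 ≤ Real.exp lam * wt lam x := by
      have := mul_le_mul_of_nonneg_left h2 (Real.exp_pos lam).le
      rwa [← Real.exp_add, add_neg_cancel, Real.exp_zero] at this
    exact le_mul_of_one_le_left (norm_nonneg _) h3
  have h4 := mul_le_mul_of_nonneg_left h1 (Real.exp_pos (-lam)).le
  rwa [← mul_assoc (Real.exp (-lam)), ← Real.exp_add, neg_add_cancel, Real.exp_zero,
    one_mul] at h4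

theorem weightL_symm (lam : ℝ) (f g : L2I) : ⟪weightL lam f, g⟫_ℝ = ⟪f, weightL lam g⟫_ℝ := by
  rw [L2.inner_def, L2.inner_def]
  refine integral_congr_ae ?_
  filter_upwards [coeFn_weightL lam f, coeFn_weightL lam g] with x hx hx'
  rw [hx, hx', real_inner_smul_left, real_inner_smul_right]

theorem norm_sq_weightL (lam : ℝ) (f : L2I) :
    ‖weightL lam f‖ ^ 2 = ∫ x in Ioo (0 : ℝ) 1, ‖f x‖ ^ 2 * Real.exp (-(2 * lam * x)) := by
  rw [norm_sq_eq_integral_norm_sq]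
  refine integral_congr_ae ?_
  filter_upwards [coeFn_weightL lam f] with x hx
  rw [hx, norm_smul, mul_pow, Real.norm_of_nonneg (wt_nonneg _ _), wt, ← Real.exp_nat_mul, mul_comm]
  congr 2
  push_cast
  ring

/-- The function `e^{-λx}` on `[0,1]`. -/
def weightC (lam : ℝ) : CI where
  toFun x := (wt lam x : ℂ)
  continuous_toFun := by have := continuous_wt lam; fun_prop

theorem weightL_inclL2 (lam : ℝ) (F : CI) : weightL lam (inclL2 F) = inclL2 (weightC lam * F) := by
  refine Lp.ext ?_
  filter_upwards [coeFn_weightL lam (inclL2 F), coeFn_inclL2 F, coeFn_inclL2 (weightC lam * F),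
    ae_restrict_mem measurableSet_Ioo] with x h1 h2 h3 hx
  rw [h1, h2, h3, CI.ext_apply _ (Ioo_subset_Icc_self hx), CI.ext_apply _ (Ioo_subset_Icc_self hx),
    Complex.real_smul]
  rfl

/-- A one-dimensional Carleman estimate: in the weighted norms, a function vanishing at `0` is
small with respect to its derivative. -/
theorem norm_weightC_mul_prim_le {lam : ℝ} (h : 0 < lam) (f : L2I) :
    ‖weightC lam * prim f‖ ≤ 1 / √(2 * lam) * ‖weightL lam f‖ := by
  refine (ContinuousMap.norm_le _ (by positivity)).2 fun ⟨x, hx⟩ => ?_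
  have hsub : Ioo 0 x ⊆ Ioo (0 : ℝ) 1 := Ioo_subset_Ioo_right hx.2
  have hle : volume.restrict (Ioo 0 x) ≤ μI := Measure.restrict_mono hsub le_rfl
  have e1 : ‖(weightC lam * prim f) ⟨x, hx⟩‖ = wt lam x * ‖∫ y in (0 : ℝ)..x, f y‖ := by
    rw [ContinuousMap.mul_apply, norm_mul, prim_apply]
    congr 1
    exact (Complex.norm_real _).trans (Real.norm_of_nonneg (wt_nonneg _ _))
  -- Writing e^{-λx} = e^{λ(y-x)} e^{-λy} leaves the kernel `a`, whose square has integral at most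
  -- 1/(2λ) over (0,x).
  set a : ℝ → ℝ := fun y => Real.exp (lam * (y - x)) with ha
  have hac : Continuous a := by fun_prop
  have e2 : wt lam x * ∫ y in Ioo 0 x, ‖f y‖ = ∫ y in Ioo 0 x, a y * ‖weightL lam f y‖ := by
    rw [← integral_const_mul]
    refine integral_congr_ae ?_
    filter_upwards [ae_mono hle (coeFn_weightL lam f)] with y hy
    rw [hy, norm_smul, Real.norm_of_nonneg (wt_nonneg _ _), ← mul_assoc, ha, wt, wt,
      ← Real.exp_add]
    congr 2
    ring
  have e3 : ∫ y in Ioo 0 x, a y ^ 2 ≤ 1 / (2 * lam) := by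
    have hd : ∀ y ∈ uIcc 0 x, HasDerivAt (fun y => Real.exp (2 * lam * (y - x)) / (2 * lam))
        (a y ^ 2) y := by
      intro y _
      have h1 : HasDerivAt (fun y => 2 * lam * (y - x)) (2 * lam * 1) y :=
        ((hasDerivAt_id y).sub_const x).const_mul (2 * lam)
      have h2 := (h1.exp).div_const (2 * lam)
      have h3 : Real.exp (2 * lam * (y - x)) * (2 * lam * 1) / (2 * lam) = a y ^ 2 := by
        rw [ha, ← Real.exp_nat_mul, mul_one, mul_div_assoc, div_self (by positivity), mul_one]
        congr 1
        push_cast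
        ring
      rwa [h3] at h2
    have hi : IntervalIntegrable (fun y => a y ^ 2) volume 0 x :=
      (hac.pow 2).intervalIntegrable _ _
    rw [← integral_Ioc_eq_integral_Ioo, ← intervalIntegral.integral_of_le hx.1,
      intervalIntegral.integral_eq_sub_of_hasDerivAt hd hi, sub_self, mul_zero, Real.exp_zero]
    have : 0 ≤ Real.exp (2 * lam * (0 - x)) / (2 * lam) := by positivity
    linarith
  rw [e1, intervalIntegral.integral_of_le hx.1, integral_Ioc_eq_integral_Ioo]
  calc wt lam x * ‖∫ y in Ioo 0 x, f y‖ ≤ wt lam x * ∫ y in Ioo 0 x, ‖f y‖ :=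
        mul_le_mul_of_nonneg_left (norm_integral_le_integral_norm _) (wt_nonneg _ _)
    _ = ∫ y in Ioo 0 x, a y * ‖weightL lam f y‖ := e2
    _ ≤ √(∫ y in Ioo 0 x, a y ^ 2) * ‖weightL lam f‖ :=
        integral_mul_norm_le _ hac (fun _ => (Real.exp_pos _).le) hx
    _ ≤ 1 / √(2 * lam) * ‖weightL lam f‖ := by
        refine mul_le_mul_of_nonneg_right ?_ (norm_nonneg _)
        rw [← Real.sqrt_one, ← Real.sqrt_div zero_le_one]
        exact Real.sqrt_le_sqrt e3

/-! ### The tail function -/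

/-- The competitor `a + b (x - x²/2)`. -/
def quadraticTail (a b : ℂ) : Sobolev 3 :=
  ⟨WithLp.toLp 2 ![inclL2 (ContinuousMap.const _ a + prim (inclL2 (ContinuousMap.const _ b
      + prim (inclL2 (ContinuousMap.const _ (-b)))))),
    inclL2 (ContinuousMap.const _ b + prim (inclL2 (ContinuousMap.const _ (-b)))),
    inclL2 (ContinuousMap.const _ (-b)), 0], by
    intro j
    fin_cases j
    · exact isWeakDeriv_const_add_prim _ _
    · exact isWeakDeriv_const_add_prim _ _
    · exact isWeakDeriv_const _⟩

theorem prim_const (b : ℂ) (x : Icc (0 : ℝ) 1) :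
    prim (inclL2 (ContinuousMap.const _ b)) x = (x : ℝ) • b := by
  rw [prim_apply, intervalIntegral.integral_of_le x.2.1, integral_Ioc_eq_integral_Ioo]
  have hle : volume.restrict (Ioo 0 (x : ℝ)) ≤ μI :=
    Measure.restrict_mono (Ioo_subset_Ioo_right x.2.2) le_rfl
  rw [integral_congr_ae (g := fun _ => b)]
  · simp [x.2.1]
  · filter_upwards [ae_mono hle (coeFn_inclL2 (ContinuousMap.const _ b))] with y hy
    rw [hy]
    rfl

/-- The derivative b(1 − x) has value b at 0 and vanishes at 1. -/
theorem quadraticTail_mem (ku : ℝ) (g₀ ℓ : ℝ → ℂ) :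
    quadraticTail (ℓ ku / (ku : ℂ) ^ 2) (Complex.I / (ku : ℂ) * (1 - 1 / g₀ ku))
      ∈ tailSet ku g₀ ℓ := by
  refine ⟨(hasValueAt_inclL2_iff _ zero_mem_unitInterval).2 ?_,
    (hasValueAt_inclL2_iff _ zero_mem_unitInterval).2 ?_,
    (hasValueAt_inclL2_iff _ one_mem_unitInterval).2 ?_⟩
  · simp only [ContinuousMap.add_apply, ContinuousMap.const_apply, prim_zero, add_zero]
  · simp only [ContinuousMap.add_apply, ContinuousMap.const_apply, prim_zero, add_zero]
  · simp only [ContinuousMap.add_apply, ContinuousMap.const_apply, prim_const, one_smul,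
      add_neg_cancel]

theorem norm_inclL2_const_le (c : ℂ) : ‖inclL2 (ContinuousMap.const _ c)‖ ≤ ‖c‖ :=
  (norm_inclL2_le _).trans ((ContinuousMap.norm_le _ (norm_nonneg _)).2 fun _ => le_rfl)

theorem norm_inclL2_const_add_prim_le (c : ℂ) (f : L2I) :
    ‖inclL2 (ContinuousMap.const _ c + prim f)‖ ≤ ‖c‖ + ‖f‖ := by
  rw [map_add]
  exact (norm_add_le _ _).trans
    (add_le_add (norm_inclL2_const_le c) ((norm_inclL2_le _).trans (norm_prim_le f)))

theorem Sobolev.norm_sq_eq (V : Sobolev 3) :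
    ‖V‖ ^ 2 = ‖V.1 0‖ ^ 2 + ‖V.1 1‖ ^ 2 + ‖V.1 2‖ ^ 2 + ‖V.1 3‖ ^ 2 := by
  have h : ‖V‖ ^ 2 = ‖V.1‖ ^ 2 := rfl
  rw [h, PiLp.norm_sq_eq_of_L2, Fin.sum_univ_four]

/-- The derivative of the tail function is bounded in terms of the boundary data. -/
theorem exists_tail_deriv_bound {ku δ : ℝ} (hδ : 0 < δ) (hδ1 : δ ≤ 1) {g₀ ℓ : ℝ → ℂ}
    {V : Sobolev 3} (hV : IsTail ku (δ ^ 2) g₀ ℓ V) {B : ℝ}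
    (ha : ‖ℓ ku / (ku : ℂ) ^ 2‖ ≤ B) (hb : ‖Complex.I / (ku : ℂ) * (1 - 1 / g₀ ku)‖ ≤ B) :
    ∃ F : CI, V.1 1 = inclL2 F ∧ ‖F‖ ≤ 6 * B := by
  obtain ⟨⟨-, hV1, -⟩, hmin⟩ := hV
  set b := Complex.I / (ku : ℂ) * (1 - 1 / g₀ ku) with hbdef
  have hB : 0 ≤ B := (norm_nonneg _).trans ha
  refine ⟨_, eq_const_add_prim (V.2 1) hV1, ?_⟩
  set U := quadraticTail (ℓ ku / (ku : ℂ) ^ 2) b with hU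
  have hle : tailFunctional (δ ^ 2) V ≤ tailFunctional (δ ^ 2) U := hmin (quadraticTail_mem ku g₀ ℓ)
  have n2 : ‖U.1 2‖ ≤ B := (norm_inclL2_const_le _).trans (by rwa [norm_neg])
  have n1 : ‖U.1 1‖ ≤ B + B :=
    (norm_inclL2_const_add_prim_le _ _).trans (add_le_add hb n2)
  have n0 : ‖U.1 0‖ ≤ B + (B + B) :=
    (norm_inclL2_const_add_prim_le _ _).trans (add_le_add ha n1)
  have n3 : ‖U.1 3‖ = 0 := norm_zero
  have s2 := pow_le_pow_left₀ (norm_nonneg _) n2 2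
  have s1 := pow_le_pow_left₀ (norm_nonneg _) n1 2
  have s0 := pow_le_pow_left₀ (norm_nonneg _) n0 2
  have nU : ‖U‖ ^ 2 ≤ 14 * B ^ 2 := by
    rw [Sobolev.norm_sq_eq, n3]
    nlinarith
  have hδ2 : δ ^ 2 ≤ 1 := pow_le_one₀ hδ.le hδ1
  -- Minimality and δ ≤ 1 give B² + 14B² ≤ 25B², uniformly in δ. Then |V'| ≤ |V'(0)| + ‖V''‖ ≤ B +
  -- 5B.
  have nV : ‖V.1 2‖ ^ 2 ≤ (5 * B) ^ 2 := by
    have h1 : ‖V.1 2‖ ^ 2 + δ ^ 2 * ‖V‖ ^ 2 ≤ ‖U.1 2‖ ^ 2 + δ ^ 2 * ‖U‖ ^ 2 := by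
      unfold tailFunctional at hle
      linarith
    have h2 : 0 ≤ δ ^ 2 * ‖V‖ ^ 2 := by positivity
    have h3 := mul_le_mul hδ2 nU (by positivity) zero_le_one
    nlinarith
  have nV' : ‖V.1 2‖ ≤ 5 * B := le_of_sq_le_sq nV (by positivity)
  refine (norm_add_le _ _).trans ?_
  have h4 : ‖ContinuousMap.const (Icc (0 : ℝ) 1) b‖ ≤ B :=
    ((ContinuousMap.norm_le _ (norm_nonneg _)).2 fun _ => le_rfl).trans hb
  have h5 := (norm_prim_le (V.1 2)).trans nV'
  have h6 : (Fin.succ (1 : Fin 3)) = 2 := rfl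
  rw [h6]
  linarith

/-! ### Energy conservation for the forward problem -/

theorem Convex.eq_of_hasDerivAt_zero {E : Type*} [NormedAddCommGroup E] [NormedSpace ℝ E]
    {f : ℝ → E} {s : Set ℝ} (hs : Convex ℝ s) (hf : ∀ x ∈ s, HasDerivAt f 0 x) {x y : ℝ}
    (hx : x ∈ s) (hy : y ∈ s) : f x = f y := by
  have h := hs.norm_image_sub_le_of_norm_hasDerivWithin_le (C := 0)
    (fun z hz => (hf z hz).hasDerivWithinAt) (fun z _ => by simp) hy hx
  rw [zero_mul] at h
  exact sub_eq_zero.1 (norm_le_zero_iff.1 h)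

namespace IsForwardSolution

variable {c : ℝ → ℝ} {x₀ k : ℝ} {u : ℝ → ℂ}

theorem hasDerivAt_norm_sq (hu : IsForwardSolution c x₀ k u) (κ : ℝ) {x : ℝ} (hx : x ≠ x₀) :
    HasDerivAt (fun x => ‖deriv u x + Complex.I * κ * u x‖ ^ 2)
      (2 * ⟪deriv u x + Complex.I * κ * u x,
        -((k : ℂ) ^ 2 * (c x : ℂ) * u x) + Complex.I * κ * deriv u x⟫_ℝ) x :=
  ((hu.ode x hx).add ((hu.differentiableAt x hx).hasDerivAt.const_mul _)).norm_sq

/-- For c = 1 the function v = u' + iκu satisfies v' = iκv, so its modulus is constant. -/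
theorem hasDerivAt_norm_sq_zero (hu : IsForwardSolution c x₀ k u) {κ : ℝ} (hκ : κ ^ 2 = k ^ 2)
    {x : ℝ} (hx : x ≠ x₀) (hc : c x = 1) :
    HasDerivAt (fun x => ‖deriv u x + Complex.I * κ * u x‖ ^ 2) 0 x := by
  refine (hu.hasDerivAt_norm_sq κ hx).congr_deriv ?_
  have hκ' : (k : ℂ) ^ 2 = (κ : ℂ) ^ 2 := by exact_mod_cast hκ.symm
  rw [hc, hκ']
  simp only [Complex.inner, Complex.mul_re, Complex.conj_re, Complex.conj_im, Complex.add_re,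
    Complex.add_im, Complex.neg_re, Complex.neg_im, Complex.mul_im, Complex.I_re, Complex.I_im,
    Complex.ofReal_re, Complex.ofReal_im, pow_two]
  ring

/-- The difference equals 4k Im(u'ū), a Wronskian of u and its conjugate. It is conserved inside the
medium too, since k²c is real. -/
theorem hasDerivAt_flux (hu : IsForwardSolution c x₀ k u) {x : ℝ} (hx : x ≠ x₀) :
    HasDerivAt (fun x => ‖deriv u x + Complex.I * k * u x‖ ^ 2
      - ‖deriv u x + Complex.I * (-k : ℝ) * u x‖ ^ 2) 0 x := by
  refine ((hu.hasDerivAt_norm_sq k hx).sub (hu.hasDerivAt_norm_sq (-k) hx)).congr_deriv ?_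
  simp only [Complex.inner, Complex.mul_re, Complex.conj_re, Complex.conj_im, Complex.add_re,
    Complex.add_im, Complex.neg_re, Complex.neg_im, Complex.mul_im, Complex.I_re, Complex.I_im,
    Complex.ofReal_re, Complex.ofReal_im, Complex.ofReal_neg, pow_two]
  ring

/-- Energy conservation bounds the field between the source and the medium. -/
theorem norm_apply_zero_le (hu : IsForwardSolution c x₀ k u) (hc : IsMedium c) (hx₀ : x₀ < 0)
    (hk : 0 < k) : ‖u 0‖ ≤ 1 / k := by
  set P : ℝ → ℝ := fun x => ‖deriv u x + Complex.I * k * u x‖ ^ 2 with hP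
  set Q : ℝ → ℝ := fun x => ‖deriv u x + Complex.I * (-k : ℝ) * u x‖ ^ 2 with hQ
  have hc0 : ∀ x, x ≤ 0 → c x = 1 := fun x hx => hc.eq_one x fun h => absurd h.1 (not_lt.2 hx)
  have hc1 : ∀ x, 1 ≤ x → c x = 1 := fun x hx => hc.eq_one x fun h => absurd h.2 (not_lt.2 hx)
  have hP2 : P 2 = 0 := by
    have h1 : ∀ x ∈ Ici (1 : ℝ), P x = P 2 := fun x hx =>
      Convex.eq_of_hasDerivAt_zero (convex_Ici (1 : ℝ)) (fun y hy =>
        hu.hasDerivAt_norm_sq_zero rfl (by have := mem_Ici.1 hy; intro h; linarith) (hc1 y hy)) hx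
        (by norm_num : (1 : ℝ) ≤ 2)
    have h2 : Tendsto P atTop (𝓝 (‖(0 : ℂ)‖ ^ 2)) := (hu.radiation_top.norm).pow 2
    have h3 : Tendsto P atTop (𝓝 (P 2)) := by
      refine tendsto_const_nhds.congr' ?_
      filter_upwards [eventually_ge_atTop 1] with x hx using (h1 x hx).symm
    simpa using tendsto_nhds_unique h3 h2
  obtain ⟨a, hal, har⟩ := hu.jump
  have hul : Tendsto u (𝓝[<] x₀) (𝓝 (u x₀)) := hu.continuous.continuousAt.tendsto.mono_left
    nhdsWithin_le_nhds
  have hur : Tendsto u (𝓝[>] x₀) (𝓝 (u x₀)) := hu.continuous.continuousAt.tendsto.mono_left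
    nhdsWithin_le_nhds
  -- Left of the source |u' − iku| is constant and tends to 0 at −∞, so its limit at the source
  -- vanishes.
  have ha : a + Complex.I * (-k : ℝ) * u x₀ = 0 := by
    have h1 : ∀ x ∈ Iio x₀, ∀ y ∈ Iio x₀, Q x = Q y := fun x hx y hy =>
      Convex.eq_of_hasDerivAt_zero (convex_Iio x₀) (fun y hy =>
        hu.hasDerivAt_norm_sq_zero (by ring) (ne_of_lt hy) (hc0 y ((mem_Iio.1 hy).trans hx₀).le))
        hx hy
    have h2 : Tendsto Q atBot (𝓝 (‖(0 : ℂ)‖ ^ 2)) := by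
      have := (hu.radiation_bot.norm).pow 2
      refine this.congr fun x => ?_
      rw [hQ]
      push_cast
      rw [mul_neg, neg_mul, ← sub_eq_add_neg]
    have h3 : Tendsto Q atBot (𝓝 (Q (x₀ - 1))) := by
      refine tendsto_const_nhds.congr' ?_
      filter_upwards [eventually_lt_atBot x₀] with x hx using h1 _ (by simp) x hx
    have h4 : Tendsto Q (𝓝[<] x₀) (𝓝 (‖a + Complex.I * (-k : ℝ) * u x₀‖ ^ 2)) :=
      ((hal.add (hul.const_mul _)).norm).pow 2
    have h5 : Tendsto Q (𝓝[<] x₀) (𝓝 (Q (x₀ - 1))) := by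
      refine tendsto_const_nhds.congr' ?_
      filter_upwards [self_mem_nhdsWithin] with x hx using h1 _ (by simp) x hx
    have h6 := tendsto_nhds_unique h4 (h5.congr fun _ => rfl)
    have h7 := tendsto_nhds_unique h3 h2
    rw [h7] at h6
    simpa using h6
  -- Across the source u' − iku jumps from 0 to −1, and its modulus is preserved up to the medium.
  have hQ0 : Q 0 = 1 := by
    have h1 : ∀ x ∈ Ioc x₀ 0, Q 0 = Q x := fun x hx =>
      Convex.eq_of_hasDerivAt_zero (convex_Ioc x₀ 0) (fun y hy =>
        hu.hasDerivAt_norm_sq_zero (by ring) (ne_of_gt hy.1) (hc0 y hy.2)) ⟨hx₀, le_rfl⟩ hx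
    have h4 : Tendsto Q (𝓝[>] x₀) (𝓝 (‖a - 1 + Complex.I * (-k : ℝ) * u x₀‖ ^ 2)) :=
      ((har.add (hur.const_mul _)).norm).pow 2
    have h5 : Tendsto Q (𝓝[>] x₀) (𝓝 (Q 0)) := by
      refine tendsto_const_nhds.congr' ?_
      filter_upwards [Ioc_mem_nhdsGT hx₀] with x hx using h1 x hx
    rw [tendsto_nhds_unique h5 h4, sub_add_eq_add_sub, ha]
    simp
  -- Flux conservation through the medium: P(0) − Q(0) = P(2) − Q(2) = −Q(2) ≤ 0.
  have hP0 : P 0 ≤ 1 := by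
    have h := Convex.eq_of_hasDerivAt_zero (convex_Ioi x₀) (fun y hy =>
        hu.hasDerivAt_flux (ne_of_gt hy)) (show (0 : ℝ) ∈ Ioi x₀ from hx₀)
        (show (2 : ℝ) ∈ Ioi x₀ from hx₀.trans two_pos)
    change P 0 - Q 0 = P 2 - Q 2 at h
    have : 0 ≤ Q 2 := sq_nonneg _
    linarith
  have n1 : ‖deriv u 0 + Complex.I * k * u 0‖ ≤ 1 := (sq_le_one_iff₀ (norm_nonneg _)).1 hP0
  have n2 : ‖deriv u 0 + Complex.I * (-k : ℝ) * u 0‖ ≤ 1 :=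
    (sq_le_one_iff₀ (norm_nonneg _)).1 hQ0.le
  have e : 2 * Complex.I * k * u 0 = (deriv u 0 + Complex.I * k * u 0)
      - (deriv u 0 + Complex.I * (-k : ℝ) * u 0) := by
    push_cast
    ring
  have n3 : ‖2 * Complex.I * k * u 0‖ ≤ 1 + 1 := by
    rw [e]
    exact (norm_sub_le _ _).trans (add_le_add n1 n2)
  have n4 : ‖2 * Complex.I * k * u 0‖ = 2 * k * ‖u 0‖ := by
    simp [abs_of_pos hk]
  rw [n4] at n3
  rw [le_div_iff₀ hk]
  linarith

end IsForwardSolution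

theorem norm_freeSolution {x₀ x k : ℝ} (hk : 0 < k) : ‖freeSolution x₀ x k‖ = 1 / (2 * k) := by
  have h : ‖Complex.exp (-(Complex.I * k * (|x - x₀| : ℝ)))‖ = 1 := by
    have : -(Complex.I * k * (|x - x₀| : ℝ)) = ((-(k * |x - x₀|) : ℝ) : ℂ) * Complex.I := by
      push_cast; ring
    rw [this, Complex.norm_exp_ofReal_mul_I]
  rw [freeSolution, norm_div, h]
  simp [abs_of_pos hk]

theorem norm_normalizedField_zero_le {c : ℝ → ℝ} {x₀ k : ℝ} {u : ℝ → ℝ → ℂ} (hx₀ : x₀ < 0)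
    (hk : 0 < k) (hc : IsMedium c) (hu : IsForwardSolution c x₀ k fun x => u x k) :
    ‖normalizedField x₀ u 0 k‖ ≤ 2 := by
  have h := hu.norm_apply_zero_le hc hx₀ hk
  rw [normalizedField, norm_div, norm_freeSolution hk, div_div_eq_mul_div, div_one]
  rw [le_div_iff₀ hk] at h
  linarith

/-! ### Bounds for the boundary data -/

/-- A continuous logarithm of a differentiable function is differentiable. -/
theorem hasDerivWithinAt_of_exp_eq {s : Set ℝ} {g ℓ : ℝ → ℂ} {g' : ℂ} {k : ℝ} (hk : k ∈ s)
    (hℓ : ContinuousWithinAt ℓ s k) (he : ∀ t ∈ s, Complex.exp (ℓ t) = g t)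
    (hg : HasDerivWithinAt g g' s k) : HasDerivWithinAt ℓ (g' / g k) s k := by
  have hg0 : g k ≠ 0 := he k hk ▸ Complex.exp_ne_zero _
  have h1 : HasDerivWithinAt (fun t => Complex.log (g t / g k) + ℓ k) (g' / g k) s k := by
    have := ((hg.div_const (g k)).clog_real (by simp [div_self hg0])).add_const (ℓ k)
    simpa [div_self hg0] using this
  -- Near k continuity keeps the imaginary part of ℓ(t) − ℓ(k) below 1 < π, so the principal branch
  -- of log(g(t)/g(k)) recovers it.
  refine h1.congr_of_eventuallyEq ?_ (by simp [div_self hg0])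
  have h2 : ∀ᶠ t in 𝓝[s] k, ‖ℓ t - ℓ k‖ < 1 := by
    have := Metric.tendsto_nhds.1 hℓ 1 one_pos
    simpa only [dist_eq_norm] using this
  filter_upwards [h2, self_mem_nhdsWithin] with t ht hts
  have h3 := (Complex.abs_im_le_norm (ℓ t - ℓ k)).trans_lt ht
  rw [abs_lt] at h3
  rw [← he t hts, ← he k hk, ← Complex.exp_sub, Complex.log_exp, sub_add_cancel]
  · linarith [Real.pi_gt_three, h3.1]
  · linarith [Real.pi_gt_three, h3.2]

/-- With q = (2i/k)(1 − 1/g₀) one has q' = p₁, so integration from ku bounds q. The identity g₀'/g₀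
= (k p₁ + q) g₀ / (2i) then bounds the derivative of log g₀, and a second integration bounds log g₀.
The factor g₀ on the right is why an upper bound N for |g₀| is needed. -/
theorem exists_bdry₀_bound {kl ku : ℝ} (hkl : 0 < kl) (hk : kl < ku) (M B N : ℝ) :
    ∃ C : ℝ, ∀ g₀ ℓ : ℝ → ℂ, IsData kl ku g₀ ℓ → (∀ k ∈ Icc kl ku, ‖g₀ k‖ ≤ N) →
      (∀ k ∈ Icc kl ku, ‖bdry₁ kl ku g₀ k‖ ≤ M) → ‖ℓ ku‖ ≤ B →
      ∀ k ∈ Icc kl ku, ‖bdry₀ kl ku ℓ k‖ ≤ C := by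
  -- Q bounds q, and P below bounds (log g₀)'; e^B bounds 1/|g₀(ku)|.
  set Q := 2 / ku * (1 + Real.exp B) + M * (ku - kl) with hQ
  set P := (M * ku + Q) / 2 * N with hP
  refine ⟨P / kl ^ 2 + 2 * (B + P * (ku - kl)) / kl ^ 3, fun g₀ ℓ hd hN hM hB => ?_⟩
  set s := Icc kl ku with hs
  have hku : 0 < ku := hkl.trans hk
  have hkus : ku ∈ s := right_mem_Icc.2 hk.le
  have hpos : ∀ k ∈ s, 0 < k := fun k h => hkl.trans_le h.1
  have hg0 : ∀ k ∈ s, g₀ k ≠ 0 := fun k h => hd.exp_eq k h ▸ Complex.exp_ne_zero _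
  have hu : UniqueDiffOn ℝ s := uniqueDiffOn_Icc hk
  have hM0 : 0 ≤ M := (norm_nonneg _).trans (hM ku hkus)
  have hN0 : 0 ≤ N := (norm_nonneg _).trans (hN ku hkus)
  have hcast : ∀ k : ℝ, HasDerivWithinAt (fun t : ℝ => (t : ℂ)) 1 s k := fun k =>
    Complex.ofRealCLM.hasDerivAt.hasDerivWithinAt
  have hg : ∀ k ∈ s, HasDerivWithinAt g₀ (derivWithin g₀ s k) s k := fun k h =>
    (hd.contDiffOn.differentiableOn (by norm_num) k h).hasDerivWithinAt
  set q : ℝ → ℂ := fun t => 2 * Complex.I / (t : ℂ) * (1 - 1 / g₀ t) with hq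
  have hq' : ∀ k ∈ s, HasDerivWithinAt q (-(q k / k)
      + 2 * Complex.I / k * (derivWithin g₀ s k / g₀ k ^ 2)) s k := by
    intro k h
    have hkc : (k : ℂ) ≠ 0 := by exact_mod_cast (hpos k h).ne'
    have h1 := ((hasDerivWithinAt_const k s (2 * Complex.I)).div (hcast k) hkc).mul
      ((hasDerivWithinAt_const k s (1 : ℂ)).sub
        ((hasDerivWithinAt_const k s (1 : ℂ)).div (hg k h) (hg0 k h)))
    refine h1.congr_deriv ?_
    have := hg0 k h
    simp only [hq, Pi.sub_apply, Pi.div_apply]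
    field_simp
    ring
  have hb : ∀ k ∈ s, bdry₁ kl ku g₀ k = -(q k / k)
      + 2 * Complex.I / k * (derivWithin g₀ s k / g₀ k ^ 2) := fun k h =>
    (hq' k h).derivWithin (hu k h)
  have hqku : ‖q ku‖ ≤ 2 / ku * (1 + Real.exp B) := by
    have h1 : ‖1 / g₀ ku‖ ≤ Real.exp B := by
      rw [← hd.exp_eq ku hkus, one_div, ← Complex.exp_neg, Complex.norm_exp]
      refine Real.exp_le_exp.2 ((le_abs_self _).trans ((Complex.abs_re_le_norm _).trans ?_))
      rwa [norm_neg]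
    have h2 : ‖2 * Complex.I / (ku : ℂ)‖ = 2 / ku := by simp [abs_of_pos hku]
    simp only [hq]
    rw [norm_mul, h2]
    refine mul_le_mul_of_nonneg_left ((norm_sub_le _ _).trans ?_) (by positivity)
    rw [norm_one]
    linarith
  have hqb : ∀ k ∈ s, ‖q k‖ ≤ Q := by
    intro k h
    have h1 := (convex_Icc kl ku).norm_image_sub_le_of_norm_hasDerivWithin_le (C := M) hq'
      (fun k h => hb k h ▸ hM k h) hkus h
    have h2 : ‖k - ku‖ ≤ ku - kl := by
      rw [Real.norm_eq_abs, abs_le]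
      constructor <;> linarith [h.1, h.2]
    have h3 := norm_le_norm_add_norm_sub (q ku) (q k)
    rw [norm_sub_rev (q ku)] at h3
    have h4 := mul_le_mul_of_nonneg_left h2 hM0
    linarith
  have hQ0 : 0 ≤ Q := (norm_nonneg _).trans (hqb ku hkus)
  have hP0 : 0 ≤ P := by positivity
  have hℓ : ∀ k ∈ s, HasDerivWithinAt ℓ (derivWithin g₀ s k / g₀ k) s k := fun k h =>
    hasDerivWithinAt_of_exp_eq h (hd.continuousOn_log k h) hd.exp_eq (hg k h)
  have hℓ' : ∀ k ∈ s, ‖derivWithin g₀ s k / g₀ k‖ ≤ P := by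
    intro k h
    have hk0 := hpos k h
    have hkc : (k : ℂ) ≠ 0 := by exact_mod_cast hk0.ne'
    have e1 : derivWithin g₀ s k / g₀ k
        = (k * bdry₁ kl ku g₀ k + q k) / (2 * Complex.I) * g₀ k := by
      have := hg0 k h
      rw [hb k h]
      field_simp
      ring
    rw [e1, norm_mul]
    refine mul_le_mul ?_ (hN k h) (norm_nonneg _) (by positivity)
    have e2 : ‖(2 * Complex.I : ℂ)‖ = 2 := by simp
    rw [norm_div, e2]
    refine div_le_div_of_nonneg_right ((norm_add_le _ _).trans (add_le_add ?_ (hqb k h))) two_pos.le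
    rw [norm_mul, Complex.norm_real, Real.norm_of_nonneg hk0.le, mul_comm M]
    exact mul_le_mul h.2 (hM k h) (norm_nonneg _) hku.le
  have hℓb : ∀ k ∈ s, ‖ℓ k‖ ≤ B + P * (ku - kl) := by
    intro k h
    have h1 := (convex_Icc kl ku).norm_image_sub_le_of_norm_hasDerivWithin_le (C := P) hℓ hℓ' hkus h
    have h2 : ‖k - ku‖ ≤ ku - kl := by
      rw [Real.norm_eq_abs, abs_le]
      constructor <;> linarith [h.1, h.2]
    have h3 := norm_le_norm_add_norm_sub (ℓ ku) (ℓ k)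
    rw [norm_sub_rev (ℓ ku)] at h3
    have h4 := mul_le_mul_of_nonneg_left h2 hP0
    linarith
  intro k h
  have hk0 := hpos k h
  have hkc : (k : ℂ) ≠ 0 := by exact_mod_cast hk0.ne'
  have e1 : bdry₀ kl ku ℓ k = derivWithin g₀ s k / g₀ k / k ^ 2 - 2 * ℓ k / k ^ 3 := by
    have h1 := ((hℓ k h).div ((hcast k).pow 2) (pow_ne_zero 2 hkc)).derivWithin (hu k h)
    refine h1.trans ?_
    field_simp
    simp
    ring
  have hkn : ‖(k : ℂ)‖ = k := by rw [Complex.norm_real, Real.norm_of_nonneg hk0.le]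
  rw [e1]
  refine (norm_sub_le _ _).trans (add_le_add ?_ ?_)
  · rw [norm_div _ ((k : ℂ) ^ 2), norm_pow, hkn]
    exact div_le_div₀ hP0 (hℓ' k h) (by positivity) (pow_le_pow_left₀ hkl.le h.1 2)
  · rw [norm_div, norm_pow, hkn, norm_mul, Complex.norm_two]
    exact div_le_div₀ (mul_nonneg two_pos.le ((norm_nonneg _).trans (hℓb k h)))
      (mul_le_mul_of_nonneg_left (hℓb k h) two_pos.le) (by positivity)
      (pow_le_pow_left₀ hkl.le h.1 3)

/-- Inside the interval this is `deriv f`, which is measurable for every f. -/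
theorem aestronglyMeasurable_derivWithin_Icc (kl ku : ℝ) (f : ℝ → ℂ) :
    AEStronglyMeasurable (fun k => derivWithin f (Icc kl ku) k) (volume.restrict (Ioo kl ku)) := by
  refine (measurable_deriv f).aestronglyMeasurable.congr ?_
  filter_upwards [ae_restrict_mem measurableSet_Ioo] with k hk
  exact (derivWithin_of_mem_nhds (Icc_mem_nhds hk.1 hk.2)).symm

/-! ### The operator `L` as a quadratic operator between Lebesgue–Bochner spaces -/

/-- The measure on `(kl, ku)`. -/
abbrev μK (kl ku : ℝ) : Measure ℝ := volume.restrict (Ioo kl ku)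

variable (kl ku : ℝ)

theorem Lp_CI_integrable {kl ku : ℝ} (z : Lp CI 2 (μK kl ku)) : Integrable z (μK kl ku) :=
  (Lp.memLp z).integrable (by norm_num)

theorem norm_intervalIntegral_le_integral_norm {E : Type*} [NormedAddCommGroup E] [NormedSpace ℝ E]
    {μ : Measure ℝ} {z : ℝ → E} (hz : Integrable z μ) (a b : ℝ) :
    ‖∫ τ in a..b, z τ ∂μ‖ ≤ ∫ τ, ‖z τ‖ ∂μ :=
  intervalIntegral.norm_integral_le_integral_norm_uIoc.trans
    (setIntegral_le_integral hz.norm (ae_of_all _ fun _ => norm_nonneg _))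

/-- A primitive in k is continuous and bounded by the L¹ norm. This gain from L² to L^∞ keeps the
products qS and S² square-integrable. -/
theorem memLp_top_tail {kl ku : ℝ} (z : Lp CI 2 (μK kl ku)) :
    MemLp (fun k => -∫ τ in k..ku, z τ ∂(μK kl ku)) ⊤ (μK kl ku) := by
  refine memLp_top_of_bound ?_ (∫ τ, ‖z τ‖ ∂(μK kl ku)) (ae_of_all _ fun k => ?_)
  · have h : Continuous fun k => ∫ τ in ku..k, z τ ∂(μK kl ku) :=
      intervalIntegral.continuous_primitive (fun a b => (Lp_CI_integrable z).intervalIntegrable) ku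
    refine (h.congr fun k => ?_).aestronglyMeasurable
    rw [intervalIntegral.integral_symm]
  · rw [norm_neg]
    exact norm_intervalIntegral_le_integral_norm (Lp_CI_integrable z) k ku

theorem exists_integral_norm_le : ∃ C : ℝ, ∀ z : Lp CI 2 (μK kl ku),
    ∫ τ, ‖z τ‖ ∂(μK kl ku) ≤ C * ‖z‖ := by
  refine ⟨((μK kl ku) univ ^ (1 / (1 : ENNReal).toReal - 1 / (2 : ENNReal).toReal)).toReal,
    fun z => ?_⟩
  rw [integral_norm_eq_lintegral_enorm (Lp.aestronglyMeasurable z), ← eLpNorm_one_eq_lintegral_enorm,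
    Lp.norm_def, mul_comm, ← ENNReal.toReal_mul]
  refine ENNReal.toReal_mono (ENNReal.mul_ne_top (Lp.eLpNorm_ne_top z) ?_)
    (eLpNorm_le_eLpNorm_mul_rpow_measure_univ (by norm_num) (Lp.aestronglyMeasurable z))
  exact ENNReal.rpow_ne_top_of_nonneg (by norm_num) (measure_ne_top _ _)

/-- The operator `q ↦ -∫_k^{ku} q dτ`. -/
def tailInt : Lp CI 2 (μK kl ku) →L[ℝ] Lp CI ⊤ (μK kl ku) :=
  LinearMap.mkContinuousOfExistsBound
    { toFun := fun z => (memLp_top_tail z).toLp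
      map_add' := fun z z' => by
        rw [← MemLp.toLp_add]
        refine MemLp.toLp_congr _ _ (ae_of_all _ fun k => ?_)
        simp only [Pi.add_apply]
        rw [← neg_add, ← intervalIntegral.integral_add (Lp_CI_integrable z).intervalIntegrable
          (Lp_CI_integrable z').intervalIntegrable]
        congr 1
        refine intervalIntegral.integral_congr_ae ?_
        filter_upwards [Lp.coeFn_add z z'] with τ hτ _ using hτ
      map_smul' := fun a z => by
        rw [RingHom.id_apply, ← MemLp.toLp_const_smul]
        refine MemLp.toLp_congr _ _ (ae_of_all _ fun k => ?_)
        simp only [Pi.smul_apply]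
        rw [smul_neg, ← intervalIntegral.integral_smul]
        congr 1
        refine intervalIntegral.integral_congr_ae ?_
        filter_upwards [Lp.coeFn_smul a z] with τ hτ _ using hτ } <| by
    obtain ⟨C, hC⟩ := exists_integral_norm_le kl ku
    refine ⟨C, fun z => ?_⟩
    have h := Lp.norm_le_of_ae_bound (f := (memLp_top_tail z).toLp)
      (C := ∫ τ, ‖z τ‖ ∂(μK kl ku)) (integral_nonneg fun _ => norm_nonneg _) (by
        filter_upwards [(memLp_top_tail z).coeFn_toLp] with k hk
        rw [hk, norm_neg]
        exact norm_intervalIntegral_le_integral_norm (Lp_CI_integrable z) k ku)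
    rw [ENNReal.toReal_top, inv_zero, Real.rpow_zero, one_mul] at h
    exact h.trans (hC z)

variable {kl ku}

theorem coeFn_tailInt (z : Lp CI 2 (μK kl ku)) :
    tailInt kl ku z =ᵐ[μK kl ku] fun k => -∫ τ in k..ku, z τ ∂(μK kl ku) :=
  (memLp_top_tail z).coeFn_toLp

variable (kl ku)

theorem memLp_top_const_of_continuous {a : ℝ → ℂ} (ha : Continuous a) :
    MemLp (fun k => ContinuousMap.const (Icc (0 : ℝ) 1) (a k)) ⊤ (μK kl ku) := by
  obtain ⟨C, hC⟩ := isCompact_Icc.exists_bound_of_continuousOn (ha.continuousOn (s := Icc kl ku))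
  refine memLp_top_of_bound ?_ C ?_
  · exact (ContinuousMap.continuous_const'.comp ha).aestronglyMeasurable
  · filter_upwards [ae_restrict_mem measurableSet_Ioo] with k hk
    exact ((ContinuousMap.norm_le _ (norm_nonneg _)).2 fun _ => le_rfl).trans
      (hC k (Ioo_subset_Icc_self hk))

/-- Multiplication of continuous functions, between Lebesgue–Bochner spaces. -/
def mulCI : Lp CI 2 (μK kl ku) →L[ℝ] Lp CI ⊤ (μK kl ku) →L[ℝ] Lp CI 2 (μK kl ku) :=
  (ContinuousLinearMap.mul ℝ CI).holderL (μK kl ku) 2 ⊤ 2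

variable {kl ku} in
theorem coeFn_mulCI (z : Lp CI 2 (μK kl ku)) (a : Lp CI ⊤ (μK kl ku)) :
    mulCI kl ku z a =ᵐ[μK kl ku] fun k => z k * a k :=
  (ContinuousLinearMap.mul ℝ CI).coeFn_holder z a

variable {kl ku} in
theorem norm_mulCI_le (z : Lp CI 2 (μK kl ku)) (a : Lp CI ⊤ (μK kl ku)) :
    ‖mulCI kl ku z a‖ ≤ ‖z‖ * ‖a‖ := by
  refine ((ContinuousLinearMap.mul ℝ CI).norm_holder_apply_apply_le z a).trans ?_
  rw [mul_assoc]
  exact mul_le_of_le_one_left (by positivity) (ContinuousLinearMap.opNorm_mul_le ℝ CI)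

/-- The quadratic operator that underlies `L`. -/
def quadL : QuadOp (HSpace kl ku) (Lp L2I 2 (μK kl ku)) (Lp CI 2 (μK kl ku))
    (Lp CI ⊤ (μK kl ku)) where
  D := H2Space.DL.compLpL 2 (μK kl ku)
  T := (prim.comp H2Space.DL).compLpL 2 (μK kl ku)
  σ := tailInt kl ku
  -- The inclusion of L^∞ into L² is written as multiplication of the constant 1, so its
  -- compatibility with the weight is a case of that for products.
  j := mulCI kl ku (Lp.const 2 (μK kl ku) 1)
  ι := inclL2.compLpL 2 (μK kl ku)
  m := mulCI kl ku
  α := (memLp_top_const_of_continuous kl ku (a := fun k => -(2 * Complex.I * k)) (by fun_prop)).toLp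
  β := (memLp_top_const_of_continuous kl ku (a := fun k => 2 * (k : ℂ) ^ 2) (by fun_prop)).toLp
  γ := (memLp_top_const_of_continuous kl ku (a := fun _ => -(2 * Complex.I)) (by fun_prop)).toLp
  η := (memLp_top_const_of_continuous kl ku (a := fun k => 2 * (k : ℂ)) (by fun_prop)).toLp

theorem exists_quadL_bounded : ∃ K₀ : ℝ, ∀ K, K₀ ≤ K → (quadL kl ku).Bounded K := by
  set S := quadL kl ku
  refine ⟨1 + ‖S.D‖ + ‖S.T‖ + ‖S.σ‖ + ‖S.j‖ + ‖S.α‖ + ‖S.β‖ + ‖S.γ‖ + ‖S.η‖, fun K hK => ?_⟩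
  have hD := norm_nonneg S.D
  have hT := norm_nonneg S.T
  have hσ := norm_nonneg S.σ
  have hj := norm_nonneg S.j
  have hα := norm_nonneg S.α
  have hβ := norm_nonneg S.β
  have hγ := norm_nonneg S.γ
  have hη := norm_nonneg S.η
  refine ⟨by linarith, S.D.le_of_opNorm_le (by linarith), S.T.le_of_opNorm_le (by linarith),
    S.σ.le_of_opNorm_le (by linarith), S.j.le_of_opNorm_le (by linarith), fun z => ?_,
    norm_mulCI_le, by linarith, by linarith, by linarith, by linarith⟩
  refine (Lp.norm_le_mul_norm_of_ae_le_mul (c := 1) ?_).trans_eq (one_mul _)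
  filter_upwards [inclL2.coeFn_compLpL z] with k hk
  rw [one_mul]
  exact (congrArg norm hk).trans_le (norm_inclL2_le _)

/-! ### Compatibility of the weight with the operator -/

variable {kl ku}

theorem coeFn_compLpL_mul_left (p : ENNReal) [Fact (1 ≤ p)] (w : CI) (z : Lp CI p (μK kl ku)) :
    (ContinuousLinearMap.mul ℝ CI w).compLpL p (μK kl ku) z =ᵐ[μK kl ku] fun k => w * z k :=
  (ContinuousLinearMap.mul ℝ CI w).coeFn_compLpL z

theorem mul_left_mulCI (w : CI) (z : Lp CI 2 (μK kl ku)) (a : Lp CI ⊤ (μK kl ku)) :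
    (ContinuousLinearMap.mul ℝ CI w).compLpL 2 (μK kl ku) (mulCI kl ku z a)
      = mulCI kl ku ((ContinuousLinearMap.mul ℝ CI w).compLpL 2 (μK kl ku) z) a := by
  refine Lp.ext ?_
  filter_upwards [coeFn_compLpL_mul_left 2 w (mulCI kl ku z a), coeFn_mulCI z a,
    coeFn_compLpL_mul_left 2 w z,
    coeFn_mulCI ((ContinuousLinearMap.mul ℝ CI w).compLpL 2 (μK kl ku) z) a] with k h1 h2 h3 h4
  rw [h1, h2, h4, h3, mul_assoc]

theorem mul_left_mulCI' (w : CI) (z : Lp CI 2 (μK kl ku)) (a : Lp CI ⊤ (μK kl ku)) :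
    (ContinuousLinearMap.mul ℝ CI w).compLpL 2 (μK kl ku) (mulCI kl ku z a)
      = mulCI kl ku z ((ContinuousLinearMap.mul ℝ CI w).compLpL ⊤ (μK kl ku) a) := by
  refine Lp.ext ?_
  filter_upwards [coeFn_compLpL_mul_left 2 w (mulCI kl ku z a), coeFn_mulCI z a,
    coeFn_compLpL_mul_left ⊤ w a,
    coeFn_mulCI z ((ContinuousLinearMap.mul ℝ CI w).compLpL ⊤ (μK kl ku) a)] with k h1 h2 h3 h4
  rw [h1, h2, h4, h3, mul_left_comm]

/-- The factor w depends on x alone, so it passes under the integral in k. -/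
theorem mul_left_tailInt (w : CI) (z : Lp CI 2 (μK kl ku)) :
    (ContinuousLinearMap.mul ℝ CI w).compLpL ⊤ (μK kl ku) (tailInt kl ku z)
      = tailInt kl ku ((ContinuousLinearMap.mul ℝ CI w).compLpL 2 (μK kl ku) z) := by
  refine Lp.ext ?_
  filter_upwards [coeFn_compLpL_mul_left ⊤ w (tailInt kl ku z), coeFn_tailInt z,
    coeFn_tailInt ((ContinuousLinearMap.mul ℝ CI w).compLpL 2 (μK kl ku) z)] with k h1 h2 h3
  rw [h1, h2, h3]
  refine (map_neg (ContinuousLinearMap.mul ℝ CI w) _).trans (congrArg _ ?_)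
  have h4 := (ContinuousLinearMap.mul ℝ CI w).intervalIntegral_comp_comm
    ((Lp_CI_integrable z).intervalIntegrable (a := k) (b := ku))
  refine h4.symm.trans (intervalIntegral.integral_congr_ae ?_)
  filter_upwards [coeFn_compLpL_mul_left 2 w z] with τ hτ _ using hτ.symm

theorem quadL_weight {lam : ℝ} (hlam : 0 < lam) :
    (quadL kl ku).Weight (1 / √(2 * lam)) ((weightL lam).compLpL 2 (μK kl ku))
      ((ContinuousLinearMap.mul ℝ CI (weightC lam)).compLpL 2 (μK kl ku))
      ((ContinuousLinearMap.mul ℝ CI (weightC lam)).compLpL ⊤ (μK kl ku)) where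
  m_left := mul_left_mulCI _
  m_right := mul_left_mulCI' _
  add := map_add _
  j := mul_left_mulCI' _ _
  σ := mul_left_tailInt _
  ι z := by
    refine Lp.ext ?_
    filter_upwards [(weightL lam).coeFn_compLpL (inclL2.compLpL 2 (μK kl ku) z),
      inclL2.coeFn_compLpL z, coeFn_compLpL_mul_left 2 (weightC lam) z, inclL2.coeFn_compLpL
        ((ContinuousLinearMap.mul ℝ CI (weightC lam)).compLpL 2 (μK kl ku) z)] with k h1 h2 h3 h4
    refine h1.trans ?_
    rw [h2, weightL_inclL2, ← h3]
    exact h4.symm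
  symm y y' := by
    rw [L2.inner_def, L2.inner_def]
    refine integral_congr_ae ?_
    filter_upwards [(weightL lam).coeFn_compLpL y, (weightL lam).coeFn_compLpL
      ((weightL lam).compLpL 2 (μK kl ku) y')] with k h1 h2
    rw [h1, h2, weightL_symm]
  -- The Carleman estimate is applied for almost every k.
  T h := by
    refine Lp.norm_le_mul_norm_of_ae_le_mul ?_
    filter_upwards [coeFn_compLpL_mul_left 2 (weightC lam)
      ((prim.comp H2Space.DL).compLpL 2 (μK kl ku) h), (prim.comp H2Space.DL).coeFn_compLpL h,
      (weightL lam).coeFn_compLpL (H2Space.DL.compLpL 2 (μK kl ku) h),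
      H2Space.DL.coeFn_compLpL h] with k h1 h2 h3 h4
    refine (congrArg norm (h1.trans (congrArg _ h2))).trans_le
      ((norm_weightC_mul_prim_le hlam (H2Space.DL (h k))).trans_eq ?_)
    rw [← h4]
    exact congrArg (fun y => 1 / √(2 * lam) * ‖y‖) h3.symm

theorem le_norm_weight_D {lam : ℝ} (hlam : 0 ≤ lam) (h : HSpace kl ku) :
    Real.exp (-lam) / 2 * ‖h‖ ≤ ‖(weightL lam).compLpL 2 (μK kl ku) ((quadL kl ku).D h)‖ := by
  have h1 : ‖h‖ ≤ 2 * Real.exp lam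
      * ‖(weightL lam).compLpL 2 (μK kl ku) ((quadL kl ku).D h)‖ := by
    refine Lp.norm_le_mul_norm_of_ae_le_mul ?_
    filter_upwards [(weightL lam).coeFn_compLpL (H2Space.DL.compLpL 2 (μK kl ku) h),
      H2Space.DL.coeFn_compLpL h] with k h3 h4
    have h5 := norm_le_norm_weightL hlam (H2Space.DL (h k))
    have h6 := H2Space.norm_le (h k)
    rw [← H2Space.DL_apply] at h6
    have h7 : ‖(((weightL lam).compLpL 2 (μK kl ku) ((quadL kl ku).D h) :
        Lp L2I 2 (μK kl ku)) : ℝ → L2I) k‖ = ‖weightL lam (H2Space.DL (h k))‖ := by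
      rw [← h4]
      exact congrArg norm h3
    rw [h7]
    have h8 := mul_le_mul_of_nonneg_left h5 (Real.exp_pos lam).le
    rw [← mul_assoc, ← Real.exp_add, add_neg_cancel, Real.exp_zero, one_mul] at h8
    linarith
  have h2 := mul_le_mul_of_nonneg_left h1 (Real.exp_pos (-lam)).le
  have h3 : Real.exp (-lam) * Real.exp lam = 1 := by
    rw [← Real.exp_add, neg_add_cancel, Real.exp_zero]
  calc Real.exp (-lam) / 2 * ‖h‖ = Real.exp (-lam) * ‖h‖ / 2 := by ring
    _ ≤ Real.exp (-lam) * (2 * Real.exp lam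
      * ‖(weightL lam).compLpL 2 (μK kl ku) ((quadL kl ku).D h)‖) / 2 := by linarith
    _ = Real.exp (-lam) * Real.exp lam
      * ‖(weightL lam).compLpL 2 (μK kl ku) ((quadL kl ku).D h)‖ := by ring
    _ = _ := by rw [h3, one_mul]

/-! ### The boundary corrector -/

theorem hasDerivAt_mFun (p₀ p₁ : ℝ → ℂ) (x k : ℝ) :
    HasDerivAt (fun y => mFun p₀ p₁ y k) (p₀ k * (4 * (x : ℂ) ^ 3 - 4 * x)
      + p₁ k * (5 * (x : ℂ) ^ 4 - 6 * (x : ℂ) ^ 2 + 1)) x := by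
  have hx : HasDerivAt (fun y : ℝ => (y : ℂ)) 1 x := Complex.ofRealCLM.hasDerivAt
  have h1 := ((hx.pow 2).sub_const 1).pow 2
  refine ((h1.mul_const (p₀ k)).add ((hx.mul h1).mul_const (p₁ k))).congr_deriv ?_
  simp only [Pi.pow_apply]
  ring

theorem hasDerivAt_deriv_mFun (p₀ p₁ : ℝ → ℂ) (x k : ℝ) :
    HasDerivAt (deriv fun y => mFun p₀ p₁ y k) (p₀ k * (12 * (x : ℂ) ^ 2 - 4)
      + p₁ k * (20 * (x : ℂ) ^ 3 - 12 * x)) x := by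
  have hd : (deriv fun y => mFun p₀ p₁ y k) = fun x : ℝ => p₀ k * (4 * (x : ℂ) ^ 3 - 4 * x)
      + p₁ k * (5 * (x : ℂ) ^ 4 - 6 * (x : ℂ) ^ 2 + 1) :=
    funext fun x => (hasDerivAt_mFun p₀ p₁ x k).deriv
  rw [hd]
  have hx : HasDerivAt (fun y : ℝ => (y : ℂ)) 1 x := Complex.ofRealCLM.hasDerivAt
  refine (((((hx.pow 3).const_mul 4).sub (hx.const_mul 4)).const_mul (p₀ k)).add
    (((((hx.pow 4).const_mul 5).sub ((hx.pow 2).const_mul 6)).add_const 1).const_mul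
      (p₁ k))).congr_deriv ?_
  push_cast
  ring

/-- The `CI`-valued function `p₀(k) P + p₁(k) Q`. -/
def profile (P Q : CI) (p₀ p₁ : ℝ → ℂ) (k : ℝ) : CI := p₀ k • P + p₁ k • Q

/-- The derivative of `(x² - 1)²`. -/
def corr₀ : CI := ⟨fun x => 4 * ((x : ℝ) : ℂ) ^ 3 - 4 * (x : ℝ), by fun_prop⟩

/-- The derivative of `x (x² - 1)²`. -/
def corr₁ : CI := ⟨fun x => 5 * ((x : ℝ) : ℂ) ^ 4 - 6 * ((x : ℝ) : ℂ) ^ 2 + 1, by fun_prop⟩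

/-- The second derivative of `(x² - 1)²`. -/
def corr₀' : CI := ⟨fun x => 12 * ((x : ℝ) : ℂ) ^ 2 - 4, by fun_prop⟩

/-- The second derivative of `x (x² - 1)²`. -/
def corr₁' : CI := ⟨fun x => 20 * ((x : ℝ) : ℂ) ^ 3 - 12 * (x : ℝ), by fun_prop⟩

theorem deriv_mFun (p₀ p₁ : ℝ → ℂ) {x : ℝ} (hx : x ∈ Icc (0 : ℝ) 1) (k : ℝ) :
    deriv (fun y => mFun p₀ p₁ y k) x = profile corr₀ corr₁ p₀ p₁ k ⟨x, hx⟩ :=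
  (hasDerivAt_mFun p₀ p₁ x k).deriv

theorem iteratedDeriv_two_mFun (p₀ p₁ : ℝ → ℂ) {x : ℝ} (hx : x ∈ Icc (0 : ℝ) 1) (k : ℝ) :
    iteratedDeriv 2 (fun y => mFun p₀ p₁ y k) x = profile corr₀' corr₁' p₀ p₁ k ⟨x, hx⟩ := by
  rw [iteratedDeriv_succ, iteratedDeriv_one]
  exact (hasDerivAt_deriv_mFun p₀ p₁ x k).deriv

variable {kl ku : ℝ}

theorem norm_profile_le {P Q : CI} {p₀ p₁ : ℝ → ℂ} {C k : ℝ} (h₀ : ‖p₀ k‖ ≤ C) (h₁ : ‖p₁ k‖ ≤ C) :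
    ‖profile P Q p₀ p₁ k‖ ≤ C * (‖P‖ + ‖Q‖) := by
  rw [mul_add]
  refine (norm_add_le _ _).trans (add_le_add ?_ ?_)
  · exact (norm_smul_le (p₀ k) P).trans (mul_le_mul_of_nonneg_right h₀ (norm_nonneg P))
  · exact (norm_smul_le (p₁ k) Q).trans (mul_le_mul_of_nonneg_right h₁ (norm_nonneg Q))

/-- The boundary functions are measurable and bounded by `C`. -/
structure BoundedData (kl ku : ℝ) (p₀ p₁ : ℝ → ℂ) (C : ℝ) : Prop where
  meas₀ : AEStronglyMeasurable p₀ (μK kl ku)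
  meas₁ : AEStronglyMeasurable p₁ (μK kl ku)
  norm₀ : ∀ k ∈ Icc kl ku, ‖p₀ k‖ ≤ C
  norm₁ : ∀ k ∈ Icc kl ku, ‖p₁ k‖ ≤ C

namespace BoundedData

variable {p₀ p₁ : ℝ → ℂ} {C : ℝ}

theorem ae_norm_profile_le (hb : BoundedData kl ku p₀ p₁ C) (P Q : CI) :
    ∀ᵐ k ∂(μK kl ku), ‖profile P Q p₀ p₁ k‖ ≤ C * (‖P‖ + ‖Q‖) := by
  filter_upwards [ae_restrict_mem measurableSet_Ioo] with k hk
  exact norm_profile_le (hb.norm₀ k (Ioo_subset_Icc_self hk)) (hb.norm₁ k (Ioo_subset_Icc_self hk))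

theorem memLp_profile (hb : BoundedData kl ku p₀ p₁ C) (P Q : CI) :
    MemLp (profile P Q p₀ p₁) 2 (μK kl ku) :=
  MemLp.of_bound ((hb.meas₀.smul_const P).add (hb.meas₁.smul_const Q)) _ (hb.ae_norm_profile_le P Q)

theorem norm_toLp_profile_le (hb : BoundedData kl ku p₀ p₁ C) (P Q : CI) (hC : 0 ≤ C) :
    ‖(hb.memLp_profile P Q).toLp‖
    ≤ measureUnivNNReal (μK kl ku) ^ (2 : ENNReal).toReal⁻¹ * (C * (‖P‖ + ‖Q‖)) := by
  refine Lp.norm_le_of_ae_bound (by positivity) ?_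
  filter_upwards [(hb.memLp_profile P Q).coeFn_toLp, hb.ae_norm_profile_le P Q] with k h1 h2
  rwa [h1]

end BoundedData

/-! ### The cost functional -/

section Cost

variable {p₀ p₁ : ℝ → ℂ} {C : ℝ}

theorem dq_eq (p : HSpace kl ku) {x : ℝ} (hx : x ∈ Icc (0 : ℝ) 1) (k : ℝ) :
    dq p₀ p₁ p x k = (prim (H2Space.DL (p k)) + profile corr₀ corr₁ p₀ p₁ k) ⟨x, hx⟩ := by
  rw [dq, H2Space.contRep_D_one _ hx, deriv_mFun _ _ hx]
  rfl

/-- The class of `p' + m'`. -/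
def dqLp (hb : BoundedData kl ku p₀ p₁ C) (p : HSpace kl ku) : Lp CI 2 (μK kl ku) :=
  (quadL kl ku).T p + (hb.memLp_profile corr₀ corr₁).toLp

theorem coeFn_dqLp (hb : BoundedData kl ku p₀ p₁ C) (p : HSpace kl ku) :
    dqLp hb p =ᵐ[μK kl ku] fun k => prim (H2Space.DL (p k)) + profile corr₀ corr₁ p₀ p₁ k := by
  filter_upwards [Lp.coeFn_add ((quadL kl ku).T p) (hb.memLp_profile corr₀ corr₁).toLp,
    (hb.memLp_profile corr₀ corr₁).coeFn_toLp, (prim.comp H2Space.DL).coeFn_compLpL p]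
    with k h1 h2 h3
  refine h1.trans ?_
  rw [Pi.add_apply, h2]
  exact congrArg (· + profile corr₀ corr₁ p₀ p₁ k) h3

/-- Classes in `Lp` are determined only up to the restricted measure, so `tailInt` integrates
against it; this returns to the plain integral in `dv`. -/
theorem intervalIntegral_μK {E : Type*} [NormedAddCommGroup E] [NormedSpace ℝ E] (z : ℝ → E)
    {k : ℝ} (hk : k ∈ Ioo kl ku) : ∫ τ in k..ku, z τ ∂(μK kl ku) = ∫ τ in k..ku, z τ := by
  rw [intervalIntegral.integral_of_le hk.2.le, intervalIntegral.integral_of_le hk.2.le,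
    Measure.restrict_restrict measurableSet_Ioc, integral_Ioc_eq_integral_Ioo]
  have : Ioc k ku ∩ Ioo kl ku = Ioo k ku := by
    ext τ
    simp only [mem_inter_iff, mem_Ioc, mem_Ioo]
    exact ⟨fun h => ⟨h.1.1, h.2.2⟩, fun h => ⟨⟨h.1, h.2.le⟩, hk.1.trans h.1, h.2⟩⟩
  rw [this]

/-- Evaluation at x is continuous and linear on `CI`, so it commutes with the Bochner integral in k.
-/
theorem dv_eq (hb : BoundedData kl ku p₀ p₁ C) {V : Sobolev 3} {F : CI} (hV : V.1 1 = inclL2 F)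
    (p : HSpace kl ku) {x : ℝ} (hx : x ∈ Icc (0 : ℝ) 1) {k : ℝ} (hk : k ∈ Ioo kl ku) :
    dv p₀ p₁ V p x k = (-(∫ τ in k..ku, dqLp hb p τ ∂(μK kl ku)) + F) ⟨x, hx⟩ := by
  have h1 : ∫ τ in k..ku, dq p₀ p₁ p x τ
      = (∫ τ in k..ku, dqLp hb p τ ∂(μK kl ku)) ⟨x, hx⟩ := by
    have h2 := (ContinuousMap.evalCLM ℝ (⟨x, hx⟩ : Icc (0 : ℝ) 1) :
      CI →L[ℝ] ℂ).intervalIntegral_comp_comm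
      ((Lp_CI_integrable (dqLp hb p)).intervalIntegrable (a := k) (b := ku))
    refine Eq.trans ?_ h2
    rw [← intervalIntegral_μK _ hk]
    refine intervalIntegral.integral_congr_ae ?_
    filter_upwards [coeFn_dqLp hb p] with τ hτ _
    rw [hτ, dq_eq p hx]
    rfl
  rw [dv, h1, hV, contRep_inclL2 F hx]
  rfl

/-- The class of `S`, the integral of `-(p' + m')` plus the derivative `F` of the tail. -/
def dvLp (hb : BoundedData kl ku p₀ p₁ C) (F : CI) (p : HSpace kl ku) : Lp CI ⊤ (μK kl ku) :=
  tailInt kl ku (dqLp hb p) + Lp.const ⊤ (μK kl ku) F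

theorem coeFn_dvLp (hb : BoundedData kl ku p₀ p₁ C) (F : CI) (p : HSpace kl ku) :
    dvLp hb F p =ᵐ[μK kl ku] fun k => -(∫ τ in k..ku, dqLp hb p τ ∂(μK kl ku)) + F := by
  filter_upwards [Lp.coeFn_add (tailInt kl ku (dqLp hb p)) (Lp.const ⊤ (μK kl ku) F),
    coeFn_tailInt (dqLp hb p), Lp.coeFn_const (p := ⊤) (μ := μK kl ku) F] with k h1 h2 h3
  refine h1.trans ?_
  rw [Pi.add_apply, h2, h3]
  rfl

theorem coeFn_N (q : Lp CI 2 (μK kl ku)) (s : Lp CI ⊤ (μK kl ku)) :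
    (quadL kl ku).N q s =ᵐ[μK kl ku] fun k =>
      q k * .const _ (-(2 * Complex.I * k)) + q k * .const _ (2 * (k : ℂ) ^ 2) * s k
        + s k * .const _ (-(2 * Complex.I)) + s k * .const _ (2 * (k : ℂ)) * s k := by
  set S := quadL kl ku with hS
  filter_upwards [Lp.coeFn_add (S.m q S.α + S.m (S.m q S.β) s + S.m (S.j s) S.γ)
      (S.m (S.m (S.j s) S.η) s),
    Lp.coeFn_add (S.m q S.α + S.m (S.m q S.β) s) (S.m (S.j s) S.γ),
    Lp.coeFn_add (S.m q S.α) (S.m (S.m q S.β) s), coeFn_mulCI q S.α, coeFn_mulCI (S.m q S.β) s,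
    coeFn_mulCI q S.β, coeFn_mulCI (S.j s) S.γ, coeFn_mulCI (S.m (S.j s) S.η) s,
    coeFn_mulCI (S.j s) S.η, coeFn_mulCI (Lp.const 2 (μK kl ku) (1 : CI)) s,
    Lp.coeFn_const (p := 2) (μ := μK kl ku) (1 : CI),
    (memLp_top_const_of_continuous kl ku (a := fun k => -(2 * Complex.I * k))
      (by fun_prop)).coeFn_toLp,
    (memLp_top_const_of_continuous kl ku (a := fun k => 2 * (k : ℂ) ^ 2) (by fun_prop)).coeFn_toLp,
    (memLp_top_const_of_continuous kl ku (a := fun _ => -(2 * Complex.I)) (by fun_prop)).coeFn_toLp,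
    (memLp_top_const_of_continuous kl ku (a := fun k => 2 * (k : ℂ)) (by fun_prop)).coeFn_toLp]
    with k h1 h2 h3 h4 h5 h6 h7 h8 h9 h10 h11 hα hβ hγ hη
  have hj : S.j s k = s k := by
    refine h10.trans ?_
    rw [h11]
    exact one_mul (s k)
  refine h1.trans ?_
  rw [Pi.add_apply, h2, Pi.add_apply, h3, Pi.add_apply]
  refine congrArg₂ (· + ·) (congrArg₂ (· + ·) (congrArg₂ (· + ·) ?_ ?_) ?_) ?_
  · exact h4.trans (congrArg _ hα)
  · exact h5.trans (congrArg (· * s k) (h6.trans (congrArg _ hβ)))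
  · refine h7.trans ?_
    rw [hj]
    exact congrArg _ hγ
  · refine h8.trans (congrArg (· * s k) (h9.trans ?_))
    rw [hj]
    exact congrArg _ hη

/-- The value of `L` on `p` as an element of `L²((kl, ku); L²(0,1))`. -/
def opLLp (hb : BoundedData kl ku p₀ p₁ C) (F : CI) (p : HSpace kl ku) : Lp L2I 2 (μK kl ku) :=
  (quadL kl ku).op ((quadL kl ku).ι (hb.memLp_profile corr₀' corr₁').toLp)
    (hb.memLp_profile corr₀ corr₁).toLp
    (tailInt kl ku (hb.memLp_profile corr₀ corr₁).toLp + Lp.const ⊤ (μK kl ku) F) p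

theorem opLLp_eq (hb : BoundedData kl ku p₀ p₁ C) (F : CI) (p : HSpace kl ku) :
    opLLp hb F p = (quadL kl ku).D p + (quadL kl ku).ι ((hb.memLp_profile corr₀' corr₁').toLp
      + (quadL kl ku).N (dqLp hb p) (dvLp hb F p)) := by
  rw [opLLp, QuadOp.op, dvLp, dqLp, map_add (tailInt kl ku), map_add (quadL kl ku).ι, add_assoc,
    add_assoc]
  rfl

/-- The iterated form (almost every k, then almost every x) matches the iterated integral in
`costJ`, so joint measurability never enters. -/
theorem ae_opLLp_eq (hb : BoundedData kl ku p₀ p₁ C) {V : Sobolev 3} {F : CI}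
    (hV : V.1 1 = inclL2 F) (p : HSpace kl ku) :
    ∀ᵐ k ∂(μK kl ku), ∀ᵐ x ∂μI, opLLp hb F p k x = opL p₀ p₁ V p x k := by
  set S := quadL kl ku with hS
  rw [opLLp_eq]
  set m' := (hb.memLp_profile corr₀' corr₁').toLp with hm'
  set n := S.N (dqLp hb p) (dvLp hb F p) with hn
  filter_upwards [Lp.coeFn_add (S.D p) (S.ι (m' + n)), H2Space.DL.coeFn_compLpL p,
    inclL2.coeFn_compLpL (m' + n), Lp.coeFn_add m' n, (hb.memLp_profile corr₀' corr₁').coeFn_toLp,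
    coeFn_N (dqLp hb p) (dvLp hb F p), coeFn_dqLp hb p, coeFn_dvLp hb F p,
    ae_restrict_mem measurableSet_Ioo] with k h1 h2 h3 h4 h5 h6 h7 h8 hk
  set G : CI := (m' + n : Lp CI 2 (μK kl ku)) k with hG
  have e1 : (S.D p + S.ι (m' + n) : Lp L2I 2 (μK kl ku)) k = (p k).D 2 + inclL2 G :=
    h1.trans (congrArg₂ (· + ·) h2 h3)
  rw [e1]
  have e2 : G = profile corr₀' corr₁' p₀ p₁ k + n k := by
    rw [h4, Pi.add_apply, h5]
  filter_upwards [Lp.coeFn_add ((p k).D 2) (inclL2 G), coeFn_inclL2 G,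
    ae_restrict_mem measurableSet_Ioo] with x g1 g2 hx
  have hx' := Ioo_subset_Icc_self hx
  have e3 : dqLp hb p k ⟨x, hx'⟩ = dq p₀ p₁ p x k := by rw [h7, dq_eq p hx']
  have e4 : dvLp hb F p k ⟨x, hx'⟩ = dv p₀ p₁ V p x k := by rw [h8, dv_eq hb hV p hx' hk]
  rw [g1, Pi.add_apply, g2, CI.ext_apply _ hx', e2, opL, iteratedDeriv_two_mFun _ _ hx', hn, h6]
  simp only [ContinuousMap.add_apply, ContinuousMap.mul_apply, ContinuousMap.const_apply, e3, e4]
  ring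

theorem costJ_eq (hb : BoundedData kl ku p₀ p₁ C) {V : Sobolev 3} {F : CI}
    (hV : V.1 1 = inclL2 F) (lam : ℝ) (p : HSpace kl ku) :
    costJ p₀ p₁ V lam p
      = Real.exp (2 * lam) * ‖(weightL lam).compLpL 2 (μK kl ku) (opLLp hb F p)‖ ^ 2 := by
  rw [costJ, norm_sq_eq_integral_norm_sq]
  congr 1
  refine integral_congr_ae ?_
  filter_upwards [ae_opLLp_eq hb hV p, (weightL lam).coeFn_compLpL (opLLp hb F p)] with k h1 h2
  have h3 : ‖((weightL lam).compLpL 2 (μK kl ku) (opLLp hb F p) : Lp L2I 2 (μK kl ku)) k‖ ^ 2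
      = ‖weightL lam (opLLp hb F p k)‖ ^ 2 := congrArg (fun y => ‖y‖ ^ 2) h2
  rw [h3, norm_sq_weightL]
  refine integral_congr_ae ?_
  filter_upwards [h1] with x hx
  rw [hx]

end Cost

/-- The threshold for `λ` depends only on bounds for the boundary data and the tail. -/
theorem exists_threshold (kl ku : ℝ) {R : ℝ} (hR : 0 ≤ R) {C B : ℝ} (hC : 0 ≤ C) (hB : 0 ≤ B) :
    ∃ lam₀ : ℝ, 1 < lam₀ ∧ ∀ p₀ p₁ : ℝ → ℂ, BoundedData kl ku p₀ p₁ C →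
      ∀ (V : Sobolev 3) (F : CI), V.1 1 = inclL2 F → ‖F‖ ≤ B → ∀ lam : ℝ, lam₀ ≤ lam →
        ∃ pmin ∈ Metric.closedBall (0 : HSpace kl ku) R,
          IsMinOn (costJ p₀ p₁ V lam) (Metric.closedBall 0 R) pmin ∧
          (∀ q ∈ Metric.closedBall (0 : HSpace kl ku) R,
            IsMinOn (costJ p₀ p₁ V lam) (Metric.closedBall 0 R) q → q = pmin) ∧
          ∃ g : HSpace kl ku, HasFDerivAt (costJ p₀ p₁ V lam) (innerSL ℝ g) pmin ∧
            ∀ y ∈ Metric.closedBall (0 : HSpace kl ku) R, 0 ≤ ⟪g, y - pmin⟫_ℝ := by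
  obtain ⟨K₀, hK₀⟩ := exists_quadL_bounded kl ku
  set cν : ℝ := measureUnivNNReal (μK kl ku) ^ (2 : ENNReal).toReal⁻¹ with hcν
  have hcν0 : 0 ≤ cν := by positivity
  set b₁ := cν * (C * (‖corr₀‖ + ‖corr₁‖)) with hb₁
  set b₂ := cν * (C * (‖corr₀'‖ + ‖corr₁'‖)) with hb₂
  have hb₁0 : 0 ≤ b₁ := by positivity
  have hb₂0 : 0 ≤ b₂ := by positivity
  set b₃ := ‖tailInt kl ku‖ * b₁ + B with hb₃
  have hb₃0 : 0 ≤ b₃ := by positivity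
  -- One constant dominates the operator norms, the data and the radius.
  set K := max K₀ (b₁ + b₂ + b₃ + R) with hK
  have hKS : (quadL kl ku).Bounded K := hK₀ K (le_max_left _ _)
  have hK' : b₁ + b₂ + b₃ + R ≤ K := le_max_right _ _
  have hK1 := hKS.one_le
  -- The Carleman factor is ε = 1/√(2λ), so λ ≥ (56K⁶)² ensures 56K⁶ε ≤ 1.
  refine ⟨(56 * K ^ 6) ^ 2, ?_, fun p₀ p₁ hb V F hV hF lam hlam => ?_⟩
  · have : 1 ≤ K ^ 6 := one_le_pow₀ hK1
    nlinarith
  have hlam0 : 0 < lam := lt_of_lt_of_le (by positivity) hlam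
  have hε : 56 * K ^ 6 * (1 / √(2 * lam)) ≤ 1 := by
    rw [mul_one_div, div_le_one (Real.sqrt_pos.2 (by positivity))]
    exact Real.le_sqrt_of_sq_le (by linarith)
  have nq : ‖(hb.memLp_profile corr₀ corr₁).toLp‖ ≤ b₁ := hb.norm_toLp_profile_le _ _ hC
  have nd : ‖(quadL kl ku).ι (hb.memLp_profile corr₀' corr₁').toLp‖ ≤ b₂ :=
    (hKS.ι _).trans (hb.norm_toLp_profile_le _ _ hC)
  have nF : ‖Lp.const ⊤ (μK kl ku) F‖ ≤ B := by
    have h := Lp.norm_le_of_ae_bound (f := Lp.const ⊤ (μK kl ku) F) hB (by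
      filter_upwards [Lp.coeFn_const (p := ⊤) (μ := μK kl ku) F] with k hk
      rw [hk]
      exact hF)
    rwa [ENNReal.toReal_top, inv_zero, Real.rpow_zero, one_mul] at h
  have ns : ‖tailInt kl ku (hb.memLp_profile corr₀ corr₁).toLp + Lp.const ⊤ (μK kl ku) F‖ ≤ b₃ :=
    (norm_add_le _ _).trans (add_le_add ((tailInt kl ku).le_opNorm_of_le nq) nF)
  exact QuadOp.exists_unique_isMinOn hKS (quadL_weight hlam0) (by positivity) hε
    (nd.trans (by linarith)) (nq.trans (by linarith)) (ns.trans (by linarith)) hR (by linarith)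
    (Real.exp_pos _) (by positivity) (le_norm_weight_D hlam0.le) (costJ_eq hb hV lam)

end CWF

end

/-! ### The main theorem -/

theorem theorem5p2
    (x₀ kl ku R M : ℝ) (hx₀ : x₀ < 0) (hkl : 0 < kl) (hk : kl < ku) (hR : 0 < R)
    (r : ℝ → ℂ) :
    ∃ lam₀ : ℝ, 1 < lam₀ ∧
      ∀ (c : ℝ → ℝ) (u ψ : ℝ → ℝ → ℂ),
        IsMedium c →
        (∀ k : ℝ, 0 < k → IsForwardSolution c x₀ k (fun x => u x k)) →
        IsLogField c x₀ (normalizedField x₀ u) ψ →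
        (∀ x ∈ Icc (0 : ℝ) 1, ψ x ku / (ku : ℂ) ^ 2 = r x / (ku : ℂ)) →
      ∀ (δ : ℝ) (g₀ ℓ : ℝ → ℂ), 0 < δ → δ ≤ 1 →
        IsData kl ku g₀ ℓ →
        NoiseBound kl ku δ g₀ ℓ (normalizedField x₀ u 0) (ψ 0) →
        (∀ k ∈ Icc kl ku, ‖bdry₁ kl ku g₀ k‖ ≤ M) →
      ∀ V : Sobolev 3, IsTail ku (δ ^ 2) g₀ ℓ V →
      ∀ lam : ℝ, lam₀ ≤ lam →
        ∃ pmin : HSpace kl ku,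
          pmin ∈ Metric.closedBall (0 : HSpace kl ku) R ∧
          IsMinOn (costJ (bdry₀ kl ku ℓ) (bdry₁ kl ku g₀) V lam)
            (Metric.closedBall (0 : HSpace kl ku) R) pmin ∧
          (∀ q ∈ Metric.closedBall (0 : HSpace kl ku) R,
            IsMinOn (costJ (bdry₀ kl ku ℓ) (bdry₁ kl ku g₀) V lam)
              (Metric.closedBall (0 : HSpace kl ku) R) q → q = pmin) ∧
          ∃ J' : HSpace kl ku,
            HasFDerivAt (costJ (bdry₀ kl ku ℓ) (bdry₁ kl ku g₀) V lam)
              (innerSL ℝ J') pmin ∧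
            ∀ y ∈ Metric.closedBall (0 : HSpace kl ku) R, 0 ≤ ⟪J', y - pmin⟫_ℝ := by
  have hku : 0 < ku := hkl.trans hk
  have hkuc : (ku : ℂ) ≠ 0 := by exact_mod_cast hku.ne'
  -- Here b bounds |log g₀(ku)|, since log g₀*(ku) = ku r*(0) and the noise is at most 1. The 3 in
  -- the next line is |g₀*| ≤ 2 plus noise, and `a` bounds both V(0) and V'(0). All these constants
  -- are fixed before c*, δ and g₀.
  set b := 1 + ku * ‖r 0‖ with hb
  obtain ⟨C, hC⟩ := exists_bdry₀_bound hkl hk M b 3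
  set a := b / ku ^ 2 + 1 / ku * (1 + Real.exp b) with ha
  have hb0 : 0 ≤ b := by positivity
  have ha0 : 0 ≤ a := by positivity
  obtain ⟨lam₀, hlam₀, H⟩ := exists_threshold kl ku hR.le (C := max 0 (max C M))
    (le_max_left _ _) (B := 6 * a) (by positivity)
  refine ⟨lam₀, hlam₀, fun c u ψ hc hu hψ hr δ g₀ ℓ hδ hδ1 hd hn hM V hV lam hlam => ?_⟩
  have hkus : ku ∈ Icc kl ku := right_mem_Icc.2 hk.le
  have hψ0 : ψ 0 ku = ku * r 0 := by
    have := hr 0 zero_mem_unitInterval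
    field_simp at this
    exact this
  have hℓ : ‖ℓ ku‖ ≤ b := by
    have h1 := norm_le_norm_add_norm_sub (ψ 0 ku) (ℓ ku)
    have h2 : ‖ψ 0 ku‖ = ku * ‖r 0‖ := by
      rw [hψ0, norm_mul, Complex.norm_real, Real.norm_of_nonneg hku.le]
    rw [norm_sub_rev, h2] at h1
    linarith [(hn ku hkus).1]
  have hg3 : ∀ k ∈ Icc kl ku, ‖g₀ k‖ ≤ 3 := by
    intro k hks
    have hk0 : 0 < k := hkl.trans_le hks.1
    have h1 := norm_le_norm_add_norm_sub (normalizedField x₀ u 0 k) (g₀ k)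
    rw [norm_sub_rev] at h1
    linarith [(hn k hks).2.1, norm_normalizedField_zero_le hx₀ hk0 hc (hu k hk0)]
  have hdata : BoundedData kl ku (bdry₀ kl ku ℓ) (bdry₁ kl ku g₀) (max 0 (max C M)) :=
    ⟨aestronglyMeasurable_derivWithin_Icc _ _ _, aestronglyMeasurable_derivWithin_Icc _ _ _,
      fun k h => (hC g₀ ℓ hd hg3 hM hℓ k h).trans ((le_max_left _ _).trans (le_max_right _ _)),
      fun k h => (hM k h).trans ((le_max_right _ _).trans (le_max_right _ _))⟩
  have hkn : ‖(ku : ℂ)‖ = ku := by rw [Complex.norm_real, Real.norm_of_nonneg hku.le]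
  have ha1 : ‖ℓ ku / (ku : ℂ) ^ 2‖ ≤ a := by
    rw [norm_div, norm_pow, hkn]
    have h1 : ‖ℓ ku‖ / ku ^ 2 ≤ b / ku ^ 2 := by gcongr
    have h2 : 0 ≤ 1 / ku * (1 + Real.exp b) := by positivity
    linarith
  have ha2 : ‖Complex.I / (ku : ℂ) * (1 - 1 / g₀ ku)‖ ≤ a := by
    have h1 : ‖1 / g₀ ku‖ ≤ Real.exp b := by
      rw [← hd.exp_eq ku hkus, one_div, ← Complex.exp_neg, Complex.norm_exp]
      refine Real.exp_le_exp.2 ((le_abs_self _).trans ((Complex.abs_re_le_norm _).trans ?_))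
      rwa [norm_neg]
    rw [norm_mul, norm_div, Complex.norm_I, hkn]
    have h2 : ‖1 - 1 / g₀ ku‖ ≤ 1 + Real.exp b :=
      (norm_sub_le _ _).trans (by rw [norm_one]; linarith)
    have h3 := mul_le_mul_of_nonneg_left h2 (show 0 ≤ 1 / ku by positivity)
    have h4 : 0 ≤ b / ku ^ 2 := by positivity
    linarith
  obtain ⟨F, hF, hFn⟩ := exists_tail_deriv_bound hδ hδ1 hV ha1 ha2
  obtain ⟨pmin, hp, h⟩ := H _ _ hdata V F hF hFn lam hlam
  exact ⟨pmin, hp, h⟩
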